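/- **Setting.** Fix $k$. An (unweighted) Boolean $k$-CSP instance $\Phi$ consists of a number $n$ of Boolean variables $x_1,\dots,x_n$ and a list of clauses $C_1,\dots,C_m$; each clause is a pair of a predicate $f:\{0,1\}^k\to\{0,1\}$ and an ordered $k$-tuple of distinct variables to which $f$ is applied. $\Phi$ is *simple* if its clauses are pairwise distinct. For an assignment $\sigma$, $val_\sigma(\Phi)$ is the fraction of the clauses satisfied by $\sigma$ (it is $1$ if there are no clauses), and $val(\Phi)=\max_\sigma val_\sigma(\Phi)$; $\Phi$ is satisfiable if $val(\Phi)=1$. For $p\in[0,1]$, the *clause percolation* $\Phi^c_p$ is the random formula over the same variables obtained by keeping each clause of $\Phi$ independently with probability $p$. An *$R$-blow-up* of $\Phi$ replaces each variable by $R$ copies, and each clause by all $R^k$ clauses with the same predicate obtained by choosing one copy of each of its variables. The input size is polynomial in $n+m$: an instance is written as a word that lists its $n$ variables and then its clauses, each by the truth table of its predicate and the indices of its variables. **Theorem.** Let $k$ be fixed and let $\varepsilon,\delta\in(0,1)$ be fixed constants. There is a polynomial-time computable map (computable by a deterministic multi-stack Turing machine in time polynomial in the length of the input word) that takes every simple unweighted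 Boolean $k$-CSP instance $\Phi$ to a simple unweighted instance $\Psi$, which is an $R$-blow-up of $\Phi$ for some $R\ge 1$ and uses the same predicates as $\Phi$, such that $val(\Psi)=val(\Phi)$ and, with $N$ the number of variables of $\Psi$, the following holds. 1. If $val(\Phi)=1$, then for every probability $p>\frac{1}{N^{k-1-\delta}}$ we have $val(\Psi^c_p)=1$ with probability $1$. 2. If $val(\Phi)<1$, then for every probability $p>\frac{1}{N^{k-1-\delta}}$, with high probability $|val(\Psi^c_p)-val(\Phi)|<\varepsilon$. That is, for every $\eta>0$ there is $N_0$ such that for every simple $\Phi$ with $val(\Phi)<1$ and $N\ge N_0$, and every probability $p>\frac1{N^{k-1-\delta}}$, the inequality holds with probability at least $1-\eta$. -/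

import Mathlib

/-- A clause of arity `k` over the Boolean variables `x_0, …, x_{n-1}`: a `k`-ary predicate together
with the (ordered, pairwise distinct) `k` variables it is applied to. -/
@[ext]
structure BoolClause (k n : ℕ) where
  pred : (Fin k → Bool) → Bool
  scope : Fin k ↪ Fin n

/-- An (unweighted) instance of Boolean `k`-CSP: a collection `C_1, …, C_m` of clauses over
`numVars` Boolean variables. -/
@[ext]
structure BoolCSP (k : ℕ) where
  numVars : ℕ
  clauses : List (BoolClause k numVars)

namespace BoolClause

/-- The assignment `σ` satisfies the clause `C`. -/
def sat {k n : ℕ} (C : BoolClause k n) (σ : Fin n → Bool) : Bool :=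
  C.pred fun i => σ (C.scope i)

end BoolClause

namespace BoolCSP

/-- All clauses of the instance are distinct. -/
def IsSimple {k : ℕ} (Φ : BoolCSP k) : Prop := Φ.clauses.Nodup

/-- The set of predicates that occur in the clauses of the instance. -/
def predicates {k : ℕ} (Φ : BoolCSP k) : Set ((Fin k → Bool) → Bool) :=
  {f | ∃ C ∈ Φ.clauses, C.pred = f}

/-- The fraction of clauses of `Φ` that `σ` satisfies. An instance with no clauses is satisfied by
every assignment, so there the value is `1`. -/
noncomputable def valOf {k : ℕ} (Φ : BoolCSP k) (σ : Fin Φ.numVars → Bool) : ℝ :=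
  if Φ.clauses = [] then 1
  else (Φ.clauses.countP fun C => C.sat σ : ℝ) / (Φ.clauses.length : ℝ)

/-- The value of `Φ`: the maximum over all assignments of the fraction of satisfied clauses. -/
noncomputable def val {k : ℕ} (Φ : BoolCSP k) : ℝ :=
  (Finset.univ : Finset (Fin Φ.numVars → Bool)).sup' Finset.univ_nonempty Φ.valOf

open Classical in
/-- The subformula of `Φ`, over the same variables, made of the clauses whose position in the list
of clauses belongs to `S`. -/
noncomputable def keep {k : ℕ} (Φ : BoolCSP k) (S : Set (Fin Φ.clauses.length)) : BoolCSP k where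
  numVars := Φ.numVars
  clauses := ((List.finRange Φ.clauses.length).filter fun i => i ∈ S).map Φ.clauses.get

/-- The law of the set of (positions of) surviving clauses in the clause percolation of `Φ`: every
clause survives independently with probability `p`. The percolated formula is `Φ.keep S`, with `S`
drawn from this law. -/
noncomputable def clausePerc {k : ℕ} (Φ : BoolCSP k) (p : unitInterval) :
    MeasureTheory.Measure (Set (Fin Φ.clauses.length)) :=
  ProbabilityTheory.setBernoulli Set.univ p

/-- `Ψ` is an `R`-blow-up of `Φ`: every variable of `Φ` is replaced by `R` copies (`π` sends a copy
to the original variable), and every clause of `Φ` by the cloud of all clauses with the same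
predicate that are obtained by choosing a copy of each of its variables. -/
def IsBlowUp {k : ℕ} (R : ℕ) (Φ Ψ : BoolCSP k) : Prop :=
  ∃ π : Fin Ψ.numVars → Fin Φ.numVars,
    (∀ v, (Finset.univ.filter fun w => π w = v).card = R) ∧
    ∀ D : BoolClause k Ψ.numVars, D ∈ Ψ.clauses ↔
      ∃ C ∈ Φ.clauses, C.pred = D.pred ∧ ∀ i, C.scope i = π (D.scope i)

/-! ### Encoding of instances as words

The alphabet is `Option Bool`: the two bits and a separator `none`. An instance lists its variables
(the number of variables is written in unary), and then its clauses, each given by the truth table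
of its predicate (`2 ^ k` bits) and the `k` indices of its variables, also in unary. As the index of
a variable is smaller than the number of variables, the length of the word is polynomially related
to `n + m`, where `n` is the number of variables and `m` the number of clauses. -/

/-- A natural number in unary, followed by a separator. -/
def unary (a : ℕ) : List (Option Bool) := List.replicate a (some true) ++ [none]

/-- The truth table of a `k`-ary predicate: its values on all inputs, where the `j`-th coordinate of
the `i`-th input is the `j`-th binary digit of `i`. -/
def truthTable {k : ℕ} (f : (Fin k → Bool) → Bool) : List (Option Bool) :=
  (List.range (2 ^ k)).map fun i => some (f fun j => i.testBit j)

/-- The word of a clause. -/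
def encodeClause {k n : ℕ} (C : BoolClause k n) : List (Option Bool) :=
  truthTable C.pred ++ (List.finRange k).flatMap fun i => unary (C.scope i)

/-- The word of an instance. -/
def encode {k : ℕ} (Φ : BoolCSP k) : List (Option Bool) :=
  unary Φ.numVars ++ Φ.clauses.flatMap encodeClause

theorem unary_append_inj : ∀ {a b : ℕ} {l l' : List (Option Bool)},
    unary a ++ l = unary b ++ l' → a = b ∧ l = l'
  | 0, 0, _, _, h => by simpa [unary] using h
  | 0, b + 1, _, _, h => by simp [unary, List.replicate_succ] at h
  | a + 1, 0, _, _, h => by simp [unary, List.replicate_succ] at h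
  | a + 1, b + 1, l, l', h => by
    have h' : unary a ++ l = unary b ++ l' := by
      simpa [unary, List.replicate_succ] using h
    obtain ⟨h1, h2⟩ := unary_append_inj h'
    exact ⟨by rw [h1], h2⟩

theorem flatMap_unary_append_inj {ι : Type} {g g' : ι → ℕ} : ∀ {L : List ι}
    {l l' : List (Option Bool)},
    (L.flatMap fun i => unary (g i)) ++ l = (L.flatMap fun i => unary (g' i)) ++ l' →
      (∀ i ∈ L, g i = g' i) ∧ l = l'
  | [], _, _, h => by simpa using h
  | i :: L, l, l', h => by
    rw [List.flatMap_cons, List.flatMap_cons, List.append_assoc, List.append_assoc] at h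
    obtain ⟨h1, h2⟩ := unary_append_inj h
    obtain ⟨h3, h4⟩ := flatMap_unary_append_inj h2
    exact ⟨by simpa [h1] using h3, h4⟩

theorem truthTable_injective {k : ℕ} :
    Function.Injective (truthTable : ((Fin k → Bool) → Bool) → List (Option Bool)) := by
  intro f g h
  funext b
  have h' : ∀ i < 2 ^ k, (f fun j => i.testBit j) = g fun j => i.testBit j := by
    simpa [truthTable] using h
  have := h' (BitVec.ofFnLE b).toNat (BitVec.ofFnLE b).isLt
  have hb : (fun j : Fin k => (BitVec.ofFnLE b).toNat.testBit j) = b := by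
    funext j
    simp
  simpa [hb] using this

theorem encodeClause_append_inj {k n : ℕ} {C D : BoolClause k n} {l l' : List (Option Bool)}
    (h : encodeClause C ++ l = encodeClause D ++ l') : C = D ∧ l = l' := by
  rw [encodeClause, encodeClause, List.append_assoc, List.append_assoc] at h
  obtain ⟨h1, h2⟩ := List.append_inj h (by simp [truthTable])
  obtain ⟨h3, h4⟩ := flatMap_unary_append_inj h2
  refine ⟨BoolClause.ext (truthTable_injective h1) ?_, h4⟩
  ext i
  exact h3 i (List.mem_finRange i)

/-- Distinct instances have distinct words. -/
theorem encode_injective {k : ℕ} :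
    Function.Injective (encode : BoolCSP k → List (Option Bool)) := by
  rintro ⟨n, L⟩ ⟨n', L'⟩ h
  obtain ⟨h1, h2⟩ := unary_append_inj h
  dsimp only at h1 h2
  subst h1
  have ne : ∀ C : BoolClause k n, encodeClause C ≠ [] := by
    intro C hC
    simpa [encodeClause, truthTable] using congrArg List.length hC
  congr 1
  clear h
  induction L generalizing L' with
  | nil => cases L' with
    | nil => rfl
    | cons D L' => simp [ne] at h2
  | cons C L ih => cases L' with
    | nil => simp [ne] at h2
    | cons D L' =>
      rw [List.flatMap_cons, List.flatMap_cons] at h2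
      obtain ⟨h3, h4⟩ := encodeClause_append_inj h2
      rw [h3, ih _ h4]

/-- `f` is computable in polynomial time (in the length of the word of the input) by a multi-stack
Turing machine. -/
def PolyTime {k : ℕ} (f : BoolCSP k → BoolCSP k) : Prop :=
  Nonempty (Turing.TM2ComputableInPolyTime (encode (k := k)) (encode (k := k)) f)

end BoolCSP

/-! The reduction is the plain blow-up with `R = (n + 1) ^ a` copies per variable, where `a` is a
constant with `a * δ ≥ k + 2`. Three independent facts make it work.

Value. Choosing one copy of each variable turns an assignment of the blow-up into an assignment of
the original instance. Averaged over all choices, the satisfied fraction of the original equals the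
satisfied fraction of the blow-up (`sum_numSat`). Hence no assignment of the blow-up beats the
optimum, and giving all copies of a variable its optimal value attains it (`val_blowUp`).

Percolation. A satisfying assignment survives any deletion of clauses, so satisfiable instances are
settled surely (`val_keep_eq_one`). Otherwise there is at least one clause, hence at least `R ^ k`
clauses in the blow-up. Since `N = R * n` and `N ^ δ ≥ (n + 1) ^ (k + 2)`, the expected number of
survivors is at least `N * (n + 1)` (`le_mul_pow_of_lt`). Chernoff's bound
(`setBernoulli_real_countIn_le`) then has an exponent superlinear in `N`, which beats the union
bound over `2 ^ N` assignments (`le_clausePerc_real`, `two_mul_exp_bound`).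

Complexity. Flow charts over stacks compose with explicit time bounds and compile to `TM2` machines
(`nonempty_polyTime`). The program handles one variable position at a time: it replaces the leading
variable of each clause by all its copies and moves it to the end. After `k` such rounds every
position has been replaced and the original order is restored (`runs_blowUpFlow`,
`polyTime_blowUp`). -/

/-! ### Structured programs over finitely many stacks -/

namespace StackFlow

/-- An instruction of a stack machine with labels in `Λ`. -/
inductive Instr (K Γ Λ : Type) : Type
  | push (s : K) (a : Γ) (l : Λ)
  | pop (s : K) (f : Option Γ → Λ)
  | peek (s : K) (f : Option Γ → Λ)

variable {K Γ Λ Λ' : Type}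

/-- Relabelling of an instruction. -/
def Instr.map (g : Λ → Λ') : Instr K Γ Λ → Instr K Γ Λ'
  | .push s a l => .push s a (g l)
  | .pop s f => .pop s (g ∘ f)
  | .peek s f => .peek s (g ∘ f)

/-- The effect of an instruction: the next label and the new content of the stacks. -/
def Instr.next [DecidableEq K] : Instr K Γ Λ → (K → List Γ) → Λ × (K → List Γ)
  | .push s a l, st => (l, Function.update st s (a :: st s))
  | .pop s f, st => (f (st s).head?, Function.update st s (st s).tail)
  | .peek s f, st => (f (st s).head?, st)

/-- The statement of a `TM2` machine that carries out an instruction. -/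
def Instr.toStmt : Instr K Γ Λ → Turing.TM2.Stmt (fun _ : K => Γ) Λ (Option Γ)
  | .push s a l => .push s (fun _ => a) (.goto fun _ => l)
  | .pop s f => .pop s (fun _ o => o) (.goto f)
  | .peek s f => .peek s (fun _ o => o) (.goto f)

theorem Instr.next_map [DecidableEq K] (g : Λ → Λ') (i : Instr K Γ Λ) (st : K → List Γ) :
    (i.map g).next st = (g (i.next st).1, (i.next st).2) := by
  cases i <;> rfl

end StackFlow

/-- A flow chart with one entry and one exit (the label `none`) over stacks indexed by `K` with
symbols in `Γ`. -/
structure StackFlow (K Γ : Type) : Type 1 where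
  Λ : Type
  [fin : Fintype Λ]
  start : Λ
  code : Λ → StackFlow.Instr K Γ (Option Λ)

namespace StackFlow

attribute [instance] StackFlow.fin

variable {K Γ : Type} [DecidableEq K]

/-- From the label `o` and the stacks `a`, the flow chart reaches its exit with the stacks `b` in at
most `t` steps. -/
inductive Path (M : StackFlow K Γ) : Option M.Λ → (K → List Γ) → ℕ → (K → List Γ) → Prop
  | exit (a : K → List Γ) (t : ℕ) : Path M none a t a
  | step {l : M.Λ} {a b : K → List Γ} {t : ℕ}
      (h : Path M ((M.code l).next a).1 ((M.code l).next a).2 t b) : Path M (some l) a (t + 1) b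

/-- Started on the stacks `a`, the flow chart stops with the stacks `b` after at most `t` steps. -/
def Runs (M : StackFlow K Γ) (a : K → List Γ) (t : ℕ) (b : K → List Γ) : Prop :=
  M.Path (some M.start) a t b

theorem Path.mono {M : StackFlow K Γ} {o : Option M.Λ} {a b : K → List Γ} {t t' : ℕ}
    (h : M.Path o a t b) (ht : t ≤ t') : M.Path o a t' b := by
  induction h generalizing t' with
  | exit a t => exact .exit _ _
  | step _ ih =>
    obtain ⟨s, rfl⟩ : ∃ s, t' = s + 1 := ⟨t' - 1, by omega⟩
    exact .step (ih (by omega))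

theorem Runs.mono {M : StackFlow K Γ} {a b : K → List Γ} {t t' : ℕ}
    (h : M.Runs a t b) (ht : t ≤ t') : M.Runs a t' b :=
  Path.mono h ht

/-- Paths can be transported along an embedding of flow charts: the embedded path is continued by
a path from the image of the exit. -/
theorem Path.embed {M N : StackFlow K Γ} (g : Option M.Λ → Option N.Λ) (e : M.Λ → N.Λ)
    (he : ∀ l, g (some l) = some (e l)) (hc : ∀ l, N.code (e l) = (M.code l).map g)
    {o : Option M.Λ} {a b c : K → List Γ} {t t' : ℕ} (h : M.Path o a t b)
    (h' : N.Path (g none) b t' c) : N.Path (g o) a (t + t') c := by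
  induction h with
  | exit a t => exact h'.mono (by omega)
  | @step l a b t _ ih =>
    rw [he, show t + 1 + t' = t + t' + 1 by omega]
    refine .step ?_
    rw [hc, Instr.next_map]
    exact ih h'

/-! #### The machine of a flow chart -/

section Machine

variable [Fintype K] [Fintype Γ]

/-- The `TM2` machine that runs a flow chart. -/
def machine (M : StackFlow K Γ) (i o : K) : Turing.FinTM2 where
  K := K
  k₀ := i
  k₁ := o
  Γ _ := Γ
  Λ := Option M.Λ
  main := some M.start
  σ := Option Γ
  initialState := none
  m
    | none => .load (fun _ => none) .halt
    | some l => (M.code l).toStmt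

/-- The internal state only carries the symbol just read to the next `goto`, so its initial value
`v` is arbitrary in the induction. The extra step is the halting statement, which also resets the
state as `haltList` requires. -/
theorem machine_evals (M : StackFlow K Γ) (i o : K) {l : Option M.Λ} {a b : K → List Γ} {t : ℕ}
    (h : M.Path l a t b) (v : Option Γ) :
    Nonempty (StateTransition.EvalsToInTime (M.machine i o).step
      (⟨some l, v, a⟩ : Turing.TM2.Cfg (fun _ : K => Γ) (Option M.Λ) (Option Γ))
      (some (⟨none, none, b⟩ : Turing.TM2.Cfg (fun _ : K => Γ) (Option M.Λ) (Option Γ)))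
      (t + 1)) := by
  induction h generalizing v with
  | exit a t => exact ⟨⟨⟨1, rfl⟩, Nat.le_add_left 1 t⟩⟩
  | @step l a b t h ih =>
    obtain ⟨w, hw⟩ : ∃ w : Option Γ, (M.machine i o).step
        (⟨some (some l), v, a⟩ : Turing.TM2.Cfg (fun _ : K => Γ) (Option M.Λ) (Option Γ)) =
        some (⟨some ((M.code l).next a).1, w, ((M.code l).next a).2⟩ :
          Turing.TM2.Cfg (fun _ : K => Γ) (Option M.Λ) (Option Γ)) := by
      simp only [machine, Turing.FinTM2.step, Turing.TM2.step]
      cases M.code l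
      · exact ⟨_, rfl⟩
      · exact ⟨_, rfl⟩
      · exact ⟨_, rfl⟩
    obtain ⟨e⟩ := ih w
    have e₁ : StateTransition.EvalsToInTime (M.machine i o).step
        (⟨some (some l), v, a⟩ : Turing.TM2.Cfg (fun _ : K => Γ) (Option M.Λ) (Option Γ))
        (some (⟨some ((M.code l).next a).1, w, ((M.code l).next a).2⟩ :
          Turing.TM2.Cfg (fun _ : K => Γ) (Option M.Λ) (Option Γ))) 1 :=
      ⟨⟨1, hw⟩, le_refl 1⟩
    exact ⟨StateTransition.EvalsToInTime.trans _ _ _ _ _ _ e₁ e⟩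

/-- A flow chart that turns the word of the input on the stack `i` into the word of the output on
the same stack (all other stacks being empty) yields a polynomial-time machine. -/
theorem nonempty_polyTime {α β : Type} {ea : α → List Γ} {eb : β → List Γ} {f : α → β}
    (M : StackFlow K Γ) (i : K) (q : Polynomial ℕ)
    (h : ∀ x, M.Runs (Function.update (fun _ => []) i (ea x)) (q.eval (ea x).length)
      (Function.update (fun _ => []) i (eb (f x)))) :
    Nonempty (Turing.TM2ComputableInPolyTime ea eb f) := by
  refine ⟨{ tm := M.machine i i, inputAlphabet := Equiv.refl _, outputAlphabet := Equiv.refl _,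
            time := q + 1, outputsFun := fun x => Classical.choice ?_ }⟩
  have key := M.machine_evals i i (h x) none
  have hst : ∀ w : List Γ, (Function.update (fun _ => []) i w : K → List Γ) = fun k =>
      @dite (List Γ) (k = i) (‹DecidableEq K› k i) (fun _ => w) fun _ => [] := by
    intro w
    funext k
    by_cases hk : k = i <;> simp [hk]
  have hid : ∀ w : List Γ, List.map (Equiv.refl Γ).invFun w = w := List.map_id
  have hi : ∀ w : List Γ, Turing.initList (M.machine i i) w =
      (⟨some (some M.start), none, Function.update (fun _ => []) i w⟩ :
        Turing.TM2.Cfg (fun _ : K => Γ) (Option M.Λ) (Option Γ)) := by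
    intro w
    rw [hst]
    simp only [Turing.initList]
    congr 1
  have ho : ∀ w : List Γ, Turing.haltList (M.machine i i) w =
      (⟨none, none, Function.update (fun _ => []) i w⟩ :
        Turing.TM2.Cfg (fun _ : K => Γ) (Option M.Λ) (Option Γ)) := by
    intro w
    rw [hst]
    simp only [Turing.haltList]
    congr 1
  have transport : ∀ {m : ℕ} {c c' d d' : (M.machine i i).Cfg}, c' = c → d' = d →
      Nonempty (StateTransition.EvalsToInTime (M.machine i i).step c (some d) m) →
      Nonempty (StateTransition.EvalsToInTime (M.machine i i).step c' (some d') m) := by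
    rintro m c _ d _ rfl rfl h
    exact h
  have hi' := (congrArg (Turing.initList (M.machine i i)) (hid (ea x))).trans (hi _)
  have ho' := (congrArg (Turing.haltList (M.machine i i)) (hid (eb (f x)))).trans (ho _)
  rw [Polynomial.eval_add, Polynomial.eval_one]
  exact transport hi' ho' key

end Machine

/-! #### Constructs -/

/-- Push a symbol. -/
def push (s : K) (a : Γ) : StackFlow K Γ where
  Λ := Unit
  start := ()
  code _ := .push s a none

/-- Do nothing. -/
def skip [Inhabited K] : StackFlow K Γ where
  Λ := Unit
  start := ()
  code _ := .peek default fun _ => none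

/-- Run one flow chart after another. -/
def seq (M N : StackFlow K Γ) : StackFlow K Γ where
  Λ := M.Λ ⊕ N.Λ
  start := .inl M.start
  code
    | .inl l => (M.code l).map fun o => some (o.elim (.inr N.start) .inl)
    | .inr l => (N.code l).map (Option.map .inr)

/-- Pop a symbol and run a flow chart that depends on it. -/
def case [Fintype Γ] (s : K) (M : Option Γ → StackFlow K Γ) : StackFlow K Γ where
  Λ := Option (Σ o, (M o).Λ)
  start := none
  code
    | none => .pop s fun o => some (some ⟨o, (M o).start⟩)
    | some ⟨o, l⟩ => ((M o).code l).map (Option.map fun l => some ⟨o, l⟩)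

/-- Repeat a flow chart as long as the top of a stack passes a test. -/
def loop (s : K) (A : Option Γ → Bool) (M : StackFlow K Γ) : StackFlow K Γ where
  Λ := Option M.Λ
  start := none
  code
    | none => .peek s fun o => if A o then some (some M.start) else none
    | some l => (M.code l).map some

theorem runs_push (s : K) (x : Γ) (a : K → List Γ) :
    (push s x).Runs a 1 (Function.update a s (x :: a s)) :=
  .step (.exit _ _)

theorem runs_skip [Inhabited K] (a : K → List Γ) : (skip : StackFlow K Γ).Runs a 1 a :=
  .step (.exit _ _)

theorem Runs.seq {M N : StackFlow K Γ} {a b c : K → List Γ} {t t' : ℕ} (h : M.Runs a t b)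
    (h' : N.Runs b t' c) : (M.seq N).Runs a (t + t') c := by
  have h₂ : (M.seq N).Path (some (.inr N.start)) b t' c := by
    have := Path.embed (N := M.seq N) (Option.map Sum.inr) Sum.inr (fun _ => rfl) (fun _ => rfl)
      h' (.exit c 0)
    exact this
  exact Path.embed (N := M.seq N) (fun o => some (o.elim (.inr N.start) .inl)) Sum.inl
    (fun _ => rfl) (fun _ => rfl) h h₂

theorem Runs.case [Fintype Γ] {s : K} {M : Option Γ → StackFlow K Γ} {a b : K → List Γ} {t : ℕ}
    (h : (M (a s).head?).Runs (Function.update a s (a s).tail) t b) :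
    (case s M).Runs a (t + 1) b := by
  refine .step ?_
  exact Path.embed (N := StackFlow.case s M)
    (Option.map fun l => some ⟨_, l⟩) (fun l => some ⟨_, l⟩) (fun _ => rfl) (fun _ => rfl) h
    (.exit b 0)

theorem runs_loop_of_false {s : K} {A : Option Γ → Bool} {M : StackFlow K Γ} {a : K → List Γ}
    (hA : A (a s).head? = false) : (loop s A M).Runs a 1 a := by
  refine .step ?_
  simp only [loop, Instr.next, hA]
  exact .exit _ _

theorem Runs.loop {s : K} {A : Option Γ → Bool} {M : StackFlow K Γ} {a b c : K → List Γ} {t t' : ℕ}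
    (hA : A (a s).head? = true) (h : M.Runs a t b) (h' : (loop s A M).Runs b t' c) :
    (loop s A M).Runs a (t + t' + 1) c := by
  refine .step ?_
  have : (StackFlow.loop s A M).Path (some (some M.start)) a (t + t') c :=
    Path.embed (N := StackFlow.loop s A M) some some (fun _ => rfl) (fun _ => rfl) h h'
  simpa [StackFlow.loop, Instr.next, hA] using this

end StackFlow

/-! ### Basic stack operations and their running times -/

namespace StackFlow

section Macros

variable {K Γ : Type} [DecidableEq K] [Inhabited K]

/-- Run a flow chart `m` times. -/
def rep : ℕ → StackFlow K Γ → StackFlow K Γ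
  | 0, _ => skip
  | m + 1, M => M.seq (rep m M)

theorem Runs.rep {M : StackFlow K Γ} {t : ℕ} : ∀ {m : ℕ} (f : ℕ → K → List Γ),
    (∀ i < m, M.Runs (f i) t (f (i + 1))) → (rep m M).Runs (f 0) (m * t + 1) (f m)
  | 0, f, _ => (runs_skip _).mono (by omega)
  | m + 1, f, h => by
    have h₁ := Runs.rep (m := m) (fun i => f (i + 1)) fun i hi => h (i + 1) (by omega)
    exact ((h 0 (by omega)).seq h₁).mono (by rw [Nat.succ_mul]; omega)

variable [Fintype Γ]

/-- As long as the top symbol passes a test, pop it and run a flow chart that depends on it. -/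
def drain (s : K) (A : Option Γ → Bool) (M : Γ → StackFlow K Γ) : StackFlow K Γ :=
  loop s A (case s fun o => o.elim skip M)

/-- Move symbols from one stack to another, as long as they pass a test. -/
def move (s t : K) (A : Option Γ → Bool) : StackFlow K Γ := drain s A (push t)

/-- Empty a stack. -/
def clear (s : K) : StackFlow K Γ := drain s Option.isSome fun _ => skip

/-- Put a copy of the content of `s` on top of `t`, using the empty stack `u`. -/
def copy (s t u : K) : StackFlow K Γ :=
  (move s u Option.isSome).seq (drain u Option.isSome fun x => (push s x).seq (push t x))

/-- Move one symbol from a stack to another. -/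
def moveOne (s t : K) : StackFlow K Γ := case s fun o => o.elim skip (push t)

/-- Remove the top symbol of a stack. -/
def drop (s : K) : StackFlow K Γ := case s fun _ => skip

theorem runs_drain_of_false {s : K} {A : Option Γ → Bool} {M : Γ → StackFlow K Γ}
    {a : K → List Γ} (hA : A (a s).head? = false) : (drain s A M).Runs a 1 a :=
  runs_loop_of_false hA

theorem Runs.drain {s : K} {A : Option Γ → Bool} {M : Γ → StackFlow K Γ} {a b c : K → List Γ}
    {x : Γ} {l : List Γ} {t t' : ℕ} (ha : a s = x :: l) (hA : A (some x) = true)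
    (h : (M x).Runs (Function.update a s l) t b) (h' : (drain s A M).Runs b t' c) :
    (drain s A M).Runs a (t + t' + 2) c := by
  have h₁ : (StackFlow.case s fun o => o.elim skip M).Runs a (t + 1) b :=
    Runs.case (by simpa [ha] using h)
  exact (Runs.loop (t := t + 1) (t' := t') (by simpa [ha] using hA) h₁ h').mono (by omega)

/-- The rest `r` fails the test at its top, so the transfer stops exactly there. Popping and pushing
reverses the block. -/
theorem runs_move {s t : K} (hst : s ≠ t) {A : Option Γ → Bool} {r : List Γ}
    (hr : A r.head? = false) : ∀ {l : List Γ} {a : K → List Γ}, a s = l ++ r →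
      (∀ x ∈ l, A (some x) = true) →
      (move s t A).Runs a (3 * l.length + 1)
        (Function.update (Function.update a s r) t (l.reverse ++ a t))
  | [], a, ha, _ => by
    have h₁ : Function.update (Function.update a s r) t ([].reverse ++ a t) = a := by
      rw [show r = a s by simpa using ha.symm]
      simp
    rw [h₁]
    exact runs_drain_of_false (by simpa [ha] using hr)
  | x :: l, a, ha, hl => by
    have ih := runs_move hst hr (l := l)
      (a := Function.update (Function.update a s (l ++ r)) t (x :: a t))
      (by simp [hst]) fun y hy => hl y (by simp [hy])
    have h₁ := runs_push t x (Function.update a s (l ++ r))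
    rw [Function.update_of_ne hst.symm] at h₁
    have h₂ := Runs.drain (A := A) (M := push t) ha (hl x (by simp)) h₁ ih
    refine (cast (congrArg _ ?_) h₂).mono (by simp; omega)
    rw [Function.update_self, Function.update_comm hst, Function.update_idem,
      Function.update_comm hst.symm, Function.update_idem]
    simp

theorem runs_clear (s : K) : ∀ {l : List Γ} {a : K → List Γ}, a s = l →
    (clear s).Runs a (3 * l.length + 1) (Function.update a s [])
  | [], a, ha => by
    rw [show Function.update a s [] = a by rw [← ha, Function.update_eq_self]]
    exact runs_drain_of_false (by simp [ha])
  | x :: l, a, ha => by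
    have ih := runs_clear s (a := Function.update a s l) (l := l) (by simp)
    rw [Function.update_idem] at ih
    exact (Runs.drain ha rfl (runs_skip _) ih).mono (by simp; omega)

/-- Second half of `copy`: unloading `u` onto two stacks at once reverses its content, which undoes
the reversal caused by loading it. -/
theorem runs_drain_push_push {s t u : K} (hsu : s ≠ u) (htu : t ≠ u) (hst : s ≠ t) :
    ∀ {l : List Γ} {a : K → List Γ}, a u = l →
      (drain u Option.isSome fun x => (push s x).seq (push t x)).Runs a (4 * l.length + 1)
        (Function.update (Function.update (Function.update a u []) s (l.reverse ++ a s)) t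
          (l.reverse ++ a t))
  | [], a, ha => by
    rw [show Function.update a u [] = a by rw [← ha, Function.update_eq_self]]
    simpa using runs_drain_of_false (by simp [ha])
  | x :: l, a, ha => by
    have h₁ := runs_push s x (Function.update a u l)
    have h₂ := runs_push t x (Function.update (Function.update a u l) s (x :: a s))
    rw [Function.update_of_ne hsu] at h₁
    rw [Function.update_of_ne hst.symm, Function.update_of_ne htu] at h₂
    have ih := runs_drain_push_push hsu htu hst (l := l)
      (a := Function.update (Function.update (Function.update a u l) s (x :: a s)) t (x :: a t))
      (by simp [hsu.symm, htu.symm])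
    have h₃ := Runs.drain (A := Option.isSome) (M := fun x => (push s x).seq (push t x)) ha rfl
      (h₁.seq h₂) ih
    refine (cast (congrArg _ ?_) h₃).mono (by simp; omega)
    funext i
    by_cases hi : i = t
    · subst hi; simp
    by_cases hi' : i = s
    · subst hi'; simp [hst]
    by_cases hu : i = u
    · subst hu; simp [hi, hi']
    · simp [hi, hi', hu]

theorem runs_copy {s t u : K} (hsu : s ≠ u) (htu : t ≠ u) (hst : s ≠ t) {a : K → List Γ}
    (hu : a u = []) :
    (copy s t u).Runs a (7 * (a s).length + 2) (Function.update a t (a s ++ a t)) := by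
  have h₁ := runs_move (A := Option.isSome) (r := []) hsu (by simp) (l := a s) (a := a) (by simp)
    fun x _ => rfl
  have h₂ := runs_drain_push_push hsu htu hst
    (l := (a s).reverse)
    (a := Function.update (Function.update a s []) u ((a s).reverse ++ a u)) (by simp [hu])
  refine (cast (congrArg _ ?_) (h₁.seq h₂)).mono (by simp; omega)
  funext i
  by_cases hi : i = t
  · subst hi; simp [htu, hst.symm]
  by_cases hi' : i = s
  · subst hi'; simp [hst, hsu]
  by_cases hiu : i = u
  · subst hiu; simp [hi, hi', hu]
  · simp [hi, hi', hiu]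

theorem runs_moveOne {s t : K} (hst : s ≠ t) {a : K → List Γ} {x : Γ} {l : List Γ}
    (ha : a s = x :: l) :
    (moveOne s t).Runs a 2 (Function.update (Function.update a s l) t (x :: a t)) := by
  have h₁ := runs_push t x (Function.update a s l)
  rw [Function.update_of_ne hst.symm] at h₁
  exact Runs.case (by simpa [ha] using h₁)

theorem runs_drop {s : K} {a : K → List Γ} {x : Γ} {l : List Γ} (ha : a s = x :: l) :
    (drop s).Runs a 2 (Function.update a s l) :=
  Runs.case (by simpa [ha] using runs_skip _)

/-- Serves for truth tables: they have fixed length `2 ^ k` and no separator, so they are moved by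
counting. -/
theorem runs_rep_moveOne {s t : K} (hst : s ≠ t) {r : List Γ} : ∀ {l : List Γ} {a : K → List Γ},
    a s = l ++ r → (rep l.length (moveOne s t)).Runs a (2 * l.length + 1)
      (Function.update (Function.update a s r) t (l.reverse ++ a t))
  | [], a, ha => by
    rw [show r = a s by simpa using ha.symm]
    simpa [rep] using runs_skip a
  | x :: l, a, ha => by
    have h₁ := runs_moveOne hst ha
    have ih := runs_rep_moveOne hst (r := r) (l := l)
      (a := Function.update (Function.update a s (l ++ r)) t (x :: a t)) (by simp [hst])
    refine (cast (congrArg _ ?_) (h₁.seq ih)).mono (by simp; omega)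
    rw [Function.update_self, Function.update_comm hst, Function.update_idem,
      Function.update_comm hst.symm, Function.update_idem]
    simp

end Macros

end StackFlow

namespace StackFlow

/-! ### The blow-up program -/

/-- The stacks of the blow-up program: input and output, number of variables, number of copies,
the clause that is being copied (two stacks), new clauses, an auxiliary stack and a counter. -/
inductive Stk : Type
  | inp | num | rep | tab | var | out | tmp | cnt
  deriving DecidableEq

instance : Fintype Stk :=
  ⟨{.inp, .num, .rep, .tab, .var, .out, .tmp, .cnt}, fun s => by cases s <;> decide⟩

instance : Inhabited Stk := ⟨.inp⟩

/-- The stacks with given contents. -/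
def store {Γ : Type} (i n r t v w u c : List Γ) : Stk → List Γ
  | .inp => i
  | .num => n
  | .rep => r
  | .tab => t
  | .var => v
  | .out => w
  | .tmp => u
  | .cnt => c

section Update

variable {Γ : Type} (i n r t v w u c x : List Γ)

@[simp] theorem store_inp : store i n r t v w u c .inp = i := rfl
@[simp] theorem store_num : store i n r t v w u c .num = n := rfl
@[simp] theorem store_rep : store i n r t v w u c .rep = r := rfl
@[simp] theorem store_tab : store i n r t v w u c .tab = t := rfl
@[simp] theorem store_var : store i n r t v w u c .var = v := rfl
@[simp] theorem store_out : store i n r t v w u c .out = w := rfl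
@[simp] theorem store_cnt : store i n r t v w u c .cnt = c := rfl

@[simp] theorem update_inp : Function.update (store i n r t v w u c) .inp x =
    store x n r t v w u c := by
  funext s; cases s <;> rfl
@[simp] theorem update_num : Function.update (store i n r t v w u c) .num x =
    store i x r t v w u c := by
  funext s; cases s <;> rfl
@[simp] theorem update_rep : Function.update (store i n r t v w u c) .rep x =
    store i n x t v w u c := by
  funext s; cases s <;> rfl
@[simp] theorem update_tab : Function.update (store i n r t v w u c) .tab x =
    store i n r x v w u c := by
  funext s; cases s <;> rfl
@[simp] theorem update_var : Function.update (store i n r t v w u c) .var x =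
    store i n r t x w u c := by
  funext s; cases s <;> rfl
@[simp] theorem update_out : Function.update (store i n r t v w u c) .out x =
    store i n r t v x u c := by
  funext s; cases s <;> rfl
@[simp] theorem update_cnt : Function.update (store i n r t v w u c) .cnt x =
    store i n r t v w u x := by
  funext s; cases s <;> rfl

end Update

/-! ### Unary numbers on stacks and the programs built on them -/

/-- The test for the digit of the unary notation. -/
def isOne (o : Option (Option Bool)) : Bool := o == some (some true)

/-- The digits of a number in unary notation. -/
def ones (a : ℕ) : List (Option Bool) := List.replicate a (some true)

theorem unary_eq (a : ℕ) : BoolCSP.unary a = ones a ++ [none] := rfl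

@[simp] theorem length_ones (a : ℕ) : (ones a).length = a := by simp [ones]

@[simp] theorem reverse_ones (a : ℕ) : (ones a).reverse = ones a := by simp [ones]

@[simp] theorem ones_zero : ones 0 = [] := rfl

theorem ones_add (a b : ℕ) : ones (a + b) = ones a ++ ones b := by
  exact List.replicate_add ..

theorem isOne_of_mem_ones {a : ℕ} {x : Option Bool} (hx : x ∈ ones a) : isOne (some x) = true := by
  rw [List.eq_of_mem_replicate hx]; rfl

/-- Read a number in unary notation, without the separator. -/
def readNum (s t : Stk) : StackFlow Stk (Option Bool) := (move s t isOne).seq (drop s)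

/-- Move a number in unary notation, with the separator, to another stack. -/
def moveNum (s t : Stk) : StackFlow Stk (Option Bool) := (move s t isOne).seq (moveOne s t)

theorem runs_readNum {s t : Stk} (hst : s ≠ t) {a : Stk → List (Option Bool)} {m : ℕ}
    {r : List (Option Bool)} (ha : a s = BoolCSP.unary m ++ r) :
    (readNum s t).Runs a (3 * m + 3)
      (Function.update (Function.update a s r) t (ones m ++ a t)) := by
  have h₁ := runs_move (A := isOne) (r := none :: r) hst rfl (l := ones m) (a := a)
    (by simp [ha, unary_eq]) fun x hx => isOne_of_mem_ones hx
  have h₂ := runs_drop (s := s) (a := Function.update (Function.update a s (none :: r)) t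
    ((ones m).reverse ++ a t)) (x := none) (l := r) (by simp [hst])
  refine (cast (congrArg _ ?_) (h₁.seq h₂)).mono (by simp)
  rw [Function.update_comm hst.symm, Function.update_idem]
  simp

theorem runs_moveNum {s t : Stk} (hst : s ≠ t) {a : Stk → List (Option Bool)} {m : ℕ}
    {r : List (Option Bool)} (ha : a s = BoolCSP.unary m ++ r) :
    (moveNum s t).Runs a (3 * m + 3)
      (Function.update (Function.update a s r) t ((BoolCSP.unary m).reverse ++ a t)) := by
  have h₁ := runs_move (A := isOne) (r := none :: r) hst rfl (l := ones m) (a := a)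
    (by simp [ha, unary_eq]) fun x hx => isOne_of_mem_ones hx
  have h₂ := runs_moveOne hst (a := Function.update (Function.update a s (none :: r)) t
    ((ones m).reverse ++ a t)) (x := none) (l := r) (by simp [hst])
  refine (cast (congrArg _ ?_) (h₁.seq h₂)).mono (by simp)
  rw [Function.update_comm hst.symm, Function.update_idem, Function.update_idem]
  simp [unary_eq]

theorem runs_rep_moveNum {s t : Stk} (hst : s ≠ t) {r : List (Option Bool)} : ∀ {vs : List ℕ}
    {a : Stk → List (Option Bool)}, a s = vs.flatMap BoolCSP.unary ++ r →
    (StackFlow.rep vs.length (moveNum s t)).Runs a (3 * (vs.flatMap BoolCSP.unary).length + 1)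
      (Function.update (Function.update a s r) t ((vs.flatMap BoolCSP.unary).reverse ++ a t))
  | [], a, ha => by
    rw [show r = a s by simpa using ha.symm]
    simpa [StackFlow.rep] using runs_skip a
  | v :: vs, a, ha => by
    have h₁ := runs_moveNum hst (a := a) (m := v) (r := vs.flatMap BoolCSP.unary ++ r)
      (by simp [ha])
    have ih := runs_rep_moveNum hst (r := r) (vs := vs)
      (a := Function.update (Function.update a s (vs.flatMap BoolCSP.unary ++ r)) t
        ((BoolCSP.unary v).reverse ++ a t)) (by simp [hst])
    refine (cast (congrArg _ ?_) (h₁.seq ih)).mono (by simp [unary_eq]; omega)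
    rw [Function.update_self, Function.update_comm hst, Function.update_idem,
      Function.update_comm hst.symm, Function.update_idem]
    simp [List.append_assoc]

/-- Write a copy of the current clause, and pass to the next copy of its variable. -/
def emit : StackFlow Stk (Option Bool) :=
  (copy .tab .out .tmp).seq ((copy .var .out .tmp).seq ((push .out none).seq (copy .num .var .tmp)))

/-- Write the copies of the current clause. -/
def emitAll : StackFlow Stk (Option Bool) := drain .cnt Option.isSome fun _ => emit

/-- Read a clause, and write all clauses obtained by replacing its first variable by a copy and
moving it to the end. -/
def rotateClause (k : ℕ) : StackFlow Stk (Option Bool) :=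
  (StackFlow.rep (2 ^ k) (moveOne .inp .tab)).seq <| (readNum .inp .var).seq <|
    (StackFlow.rep (k - 1) (moveNum .inp .tab)).seq <| (copy .rep .cnt .tmp).seq <|
    emitAll.seq <| (clear .tab).seq (clear .var)

/-- Carry out `rotateClause` for all clauses. -/
def rotateAll (k : ℕ) : StackFlow Stk (Option Bool) :=
  (loop .inp Option.isSome (rotateClause k)).seq (move .out .inp Option.isSome)

/-- Multiply the number of copies by one plus the number of variables. -/
def multiply : StackFlow Stk (Option Bool) :=
  (move .rep .cnt Option.isSome).seq
    (drain .cnt Option.isSome fun _ => (copy .num .rep .tmp).seq (push .rep (some true)))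

/-- Write the number of variables of the blow-up. -/
def writeNum : StackFlow Stk (Option Bool) :=
  (push .inp none).seq <| (drain .rep Option.isSome fun _ => copy .num .inp .tmp).seq (clear .num)

/-- The program that computes the `(n + 1) ^ a`-blow-up. -/
def blowUpFlow (k a : ℕ) : StackFlow Stk (Option Bool) :=
  (readNum .inp .num).seq <| (push .rep (some true)).seq <| (StackFlow.rep a multiply).seq <|
    (StackFlow.rep k (rotateAll k)).seq writeNum

/-! ### Correctness and running time of the blow-up program -/

theorem runs_emit (i n r t v w c : List (Option Bool)) :
    emit.Runs (store i n r t v w [] c) (7 * (t.length + v.length + n.length + 1))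
      (store i n r t (n ++ v) (none :: (v ++ (t ++ w))) [] c) := by
  have h₁ := runs_copy (s := .tab) (t := .out) (u := .tmp) (by decide) (by decide) (by decide)
    (a := store i n r t v w [] c) rfl
  have h₂ := runs_copy (s := .var) (t := .out) (u := .tmp) (by decide) (by decide) (by decide)
    (a := store i n r t v (t ++ w) [] c) rfl
  have h₃ := runs_push .out none (store i n r t v (v ++ (t ++ w)) [] c)
  have h₄ := runs_copy (s := .num) (t := .var) (u := .tmp) (by decide) (by decide) (by decide)
    (a := store i n r t v (none :: (v ++ (t ++ w))) [] c) rfl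
  simp only [store_tab, store_out, store_var, store_num, update_out, update_var]
    at h₁ h₂ h₃ h₄
  exact (h₁.seq (h₂.seq (h₃.seq h₄))).mono (by omega)

/-- The copies of a variable have indices in arithmetic progression with difference `N`, so adding
`N` digits to `.var` passes to the next copy. The bound on `V + N * c` controls the length of `.var`
until the end of the loop. -/
theorem runs_emitAll {B N : ℕ} (i r t : List (Option Bool)) (ht : t.length ≤ B) (hN : N ≤ B) :
    ∀ (c V : ℕ) (w : List (Option Bool)), V + N * c ≤ B →
      emitAll.Runs (store i (ones N) r t (ones V) w [] (ones c)) (c * (21 * B + 9) + 1)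
        (store i (ones N) r t (ones (V + N * c))
          (((List.range c).flatMap fun j => t.reverse ++ BoolCSP.unary (V + N * j)).reverse ++ w)
          [] [])
  | 0, V, w, _ => by
    simpa [emitAll] using runs_drain_of_false (by rfl)
  | c + 1, V, w, h => by
    rw [Nat.mul_succ] at h
    have h₁ := runs_emit i (ones N) r t (ones V) w (ones c)
    have ih := runs_emitAll i r t ht hN c (N + V) (none :: (ones V ++ (t ++ w))) (by omega)
    rw [ones_add] at ih
    have h₂ := Runs.drain (s := Stk.cnt) (A := Option.isSome) (M := fun _ : Option Bool => emit)
      (a := store i (ones N) r t (ones V) w [] (ones (c + 1))) (x := some true) (l := ones c)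
      (by simp [ones, List.replicate_succ]) rfl (by simpa using h₁) ih
    refine (cast (congrArg _ ?_) h₂).mono (by simp only [Nat.succ_mul]; omega)
    have e : ∀ j, N + V + N * j = V + N * (j + 1) := fun j => by ring
    simp [List.range_succ_eq_map, List.flatMap_map, unary_eq, e]

/-- The words of a clause, given by the truth table and the variables. -/
def clauseWord (d : List (Option Bool) × List ℕ) : List (Option Bool) :=
  d.1 ++ d.2.flatMap BoolCSP.unary

/-- The clauses obtained by replacing the first variable by a copy and moving it to the end. -/
def rotated (N R : ℕ) : List (Option Bool) × List ℕ → List (List (Option Bool) × List ℕ)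
  | (_, []) => []
  | (τ, v :: vs) => (List.range R).map fun j => (τ, vs ++ [v + N * j])

/-- Filling `.tab` by popping stores the truth table and the remaining variables in reverse. The
output stack is reversed too, so a verbatim copy of `.tab` has the right orientation there. -/
theorem runs_rotateClause {B N R k : ℕ} {τ : List (Option Bool)} {v : ℕ} {vs : List ℕ}
    (hτ : τ.length = 2 ^ k) (hvs : vs.length = k - 1)
    (ht : (clauseWord (τ, vs)).length ≤ B) (hv : v + N * R ≤ B) (hN : N ≤ B) (hR : R ≤ B)
    (i w : List (Option Bool)) :
    (rotateClause k).Runs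
      (store (clauseWord (τ, v :: vs) ++ i) (ones N) (ones R) [] [] w [] [])
      (30 * (B + 1) ^ 2)
      (store i (ones N) (ones R) [] []
        (((rotated N R (τ, v :: vs)).flatMap clauseWord).reverse ++ w) [] []) := by
  have h₁ := runs_rep_moveOne (s := Stk.inp) (t := Stk.tab) (by decide)
    (r := BoolCSP.unary v ++ (vs.flatMap BoolCSP.unary ++ i)) (l := τ)
    (a := store (clauseWord (τ, v :: vs) ++ i) (ones N) (ones R) [] [] w [] [])
    (by simp [clauseWord])
  rw [hτ] at h₁
  simp only [update_inp, store_tab, update_tab, List.append_nil] at h₁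
  have h₂ := runs_readNum (s := .inp) (t := .var) (by decide) (m := v)
    (r := vs.flatMap BoolCSP.unary ++ i)
    (a := store (BoolCSP.unary v ++ (vs.flatMap BoolCSP.unary ++ i)) (ones N) (ones R) τ.reverse
      [] w [] []) (by simp)
  simp only [update_inp, store_var, update_var, List.append_nil] at h₂
  have h₃ := runs_rep_moveNum (s := .inp) (t := .tab) (by decide) (r := i) (vs := vs)
    (a := store (vs.flatMap BoolCSP.unary ++ i) (ones N) (ones R) τ.reverse
      (ones v) w [] []) (by simp)
  rw [hvs] at h₃
  simp only [update_inp, store_tab, update_tab] at h₃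
  rw [← List.reverse_append] at h₃
  change StackFlow.Runs _ _ _ (store i (ones N) (ones R) (clauseWord (τ, vs)).reverse _ w [] [])
    at h₃
  have h₄ := runs_copy (s := .rep) (t := .cnt) (u := .tmp) (by decide) (by decide) (by decide)
    (a := store i (ones N) (ones R) (clauseWord (τ, vs)).reverse (ones v) w [] []) rfl
  simp only [update_cnt, store_rep, store_cnt, List.append_nil] at h₄
  have h₅ := runs_emitAll i (ones R) (clauseWord (τ, vs)).reverse (by simpa using ht) hN R v w hv
  have h₆ := runs_clear Stk.tab (a := store i (ones N) (ones R) (clauseWord (τ, vs)).reverse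
    (ones (v + N * R)) (((List.range R).flatMap fun j => (clauseWord (τ, vs)).reverse.reverse ++
      BoolCSP.unary (v + N * j)).reverse ++ w) [] []) rfl
  have h₇ := runs_clear Stk.var (a := store i (ones N) (ones R) []
    (ones (v + N * R)) (((List.range R).flatMap fun j => (clauseWord (τ, vs)).reverse.reverse ++
      BoolCSP.unary (v + N * j)).reverse ++ w) [] []) rfl
  simp only [update_tab, update_var] at h₆ h₇
  refine (cast (congrArg _ ?_)
    (h₁.seq (h₂.seq (h₃.seq (h₄.seq (h₅.seq (h₆.seq h₇))))))).mono ?_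
  · simp [rotated, List.flatMap_map, clauseWord]
  · have e₁ : R * (21 * B + 9) ≤ B * (21 * B + 9) := Nat.mul_le_mul_right _ hR
    have e₂ : (clauseWord (τ, vs)).length = τ.length + (vs.flatMap BoolCSP.unary).length := by
      simp [clauseWord]
    simp only [store_tab, store_var, List.length_reverse, length_ones]
    nlinarith

theorem runs_loop_rotateClause {B N R k : ℕ} (hk : 0 < k) (hN : N ≤ B) (hR : R ≤ B) :
    ∀ (D : List (List (Option Bool) × List ℕ)) (w : List (Option Bool)),
      (∀ d ∈ D, d.1.length = 2 ^ k ∧ d.2.length = k ∧ (clauseWord d).length + N * R ≤ B) →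
      (loop .inp Option.isSome (rotateClause k)).Runs
        (store (D.flatMap clauseWord) (ones N) (ones R) [] [] w [] [])
        (D.length * (30 * (B + 1) ^ 2 + 1) + 1)
        (store [] (ones N) (ones R) [] []
          (((D.flatMap (rotated N R)).flatMap clauseWord).reverse ++ w) [] [])
  | [], w, _ => by
    simpa using runs_loop_of_false (by rfl)
  | (τ, u) :: D, w, h => by
    obtain ⟨hτ, hu, hB⟩ := h _ List.mem_cons_self
    obtain _ | ⟨v, vs⟩ := u
    · simp at hu; omega
    simp only [List.length_cons] at hτ hu
    have hB' : τ.length + (v + 1 + (vs.flatMap BoolCSP.unary).length) + N * R ≤ B := by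
      simp only [clauseWord, unary_eq, List.flatMap_cons, List.length_append, length_ones,
        List.length_singleton] at hB ⊢
      exact hB
    have h₁ := runs_rotateClause (B := B) (N := N) (R := R) (τ := τ) (v := v) (vs := vs) hτ
      (by omega) (by simp only [clauseWord, List.length_append]; omega) (by omega) hN hR
      (D.flatMap clauseWord) w
    have ih := runs_loop_rotateClause hk hN hR D
      (((rotated N R (τ, v :: vs)).flatMap clauseWord).reverse ++ w)
      fun d hd => h d (List.mem_cons_of_mem _ hd)
    -- A truth table has `2 ^ k ≥ 1` entries, so the input stack is nonempty as long as a clause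
    -- remains.
    have hA : Option.isSome (store (((τ, v :: vs) :: D).flatMap clauseWord) (ones N) (ones R)
        [] [] w [] [] Stk.inp).head? = true := by
      obtain _ | ⟨x, τ⟩ := τ
      · have := Nat.two_pow_pos k
        simp at hτ
        omega
      · simp [clauseWord]
    rw [List.flatMap_cons] at hA ⊢
    refine (cast (congrArg _ ?_) (Runs.loop hA h₁ ih)).mono ?_
    · simp
    · simp only [List.length_cons, Nat.succ_mul]; omega

theorem runs_rotateAll {B N R k : ℕ} (hk : 0 < k) (hN : N ≤ B) (hR : R ≤ B)
    (D : List (List (Option Bool) × List ℕ))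
    (hD : ∀ d ∈ D, d.1.length = 2 ^ k ∧ d.2.length = k ∧ (clauseWord d).length + N * R ≤ B)
    (hl : D.length ≤ B) (hl' : ((D.flatMap (rotated N R)).flatMap clauseWord).length ≤ B) :
    (rotateAll k).Runs (store (D.flatMap clauseWord) (ones N) (ones R) [] [] [] [] [])
      (40 * (B + 1) ^ 3)
      (store ((D.flatMap (rotated N R)).flatMap clauseWord) (ones N) (ones R) [] [] [] [] []) := by
  have h₁ := runs_loop_rotateClause hk hN hR D [] hD
  have h₂ := runs_move (s := Stk.out) (t := Stk.inp) (by decide) (A := Option.isSome) (r := [])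
    rfl (l := ((D.flatMap (rotated N R)).flatMap clauseWord).reverse ++ [])
    (a := store [] (ones N) (ones R) [] []
          (((D.flatMap (rotated N R)).flatMap clauseWord).reverse ++ []) [] []) (by simp)
    fun x _ => rfl
  refine (cast (congrArg _ ?_) (h₁.seq h₂)).mono ?_
  · simp
  · have e₁ : D.length * (30 * (B + 1) ^ 2 + 1) ≤ B * (30 * (B + 1) ^ 2 + 1) :=
      Nat.mul_le_mul_right _ hl
    simp only [List.append_nil, List.length_reverse]
    nlinarith [Nat.zero_le (B ^ 2), Nat.zero_le (B ^ 3)]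

theorem runs_drain_multiply {N : ℕ} (i : List (Option Bool)) : ∀ (c V : ℕ),
    (drain .cnt Option.isSome fun _ => (copy .num .rep .tmp).seq (push .rep (some true))).Runs
      (store i (ones N) (ones V) [] [] [] [] (ones c)) (c * (7 * N + 5) + 1)
      (store i (ones N) (ones (V + c * (N + 1))) [] [] [] [] [])
  | 0, V => by
    simpa using runs_drain_of_false (by rfl)
  | c + 1, V => by
    have h₁ := runs_copy (s := .num) (t := .rep) (u := .tmp) (by decide) (by decide) (by decide)
      (a := store i (ones N) (ones V) [] [] [] [] (ones c)) rfl
    have h₂ := runs_push .rep (some true)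
      (store i (ones N) (ones N ++ ones V) [] [] [] [] (ones c))
    simp only [store_num, store_rep, update_rep] at h₁ h₂
    have e : some true :: (ones N ++ ones V) = ones (V + (N + 1)) := by
      rw [← ones_add, show V + (N + 1) = N + V + 1 by ring]; rfl
    rw [e] at h₂
    have h₃ := Runs.drain (s := Stk.cnt) (A := Option.isSome)
      (M := fun _ : Option Bool => (copy Stk.num .rep .tmp).seq (push .rep (some true)))
      (a := store i (ones N) (ones V) [] [] [] [] (ones (c + 1))) (x := some true) (l := ones c)
      (by simp [ones, List.replicate_succ]) rfl (by simpa using h₁.seq h₂)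
      (runs_drain_multiply i c (V + (N + 1)))
    refine (cast (congrArg _ ?_) h₃).mono ?_
    · rw [show V + (N + 1) + c * (N + 1) = V + (c + 1) * (N + 1) by ring]
    · simp only [Nat.succ_mul]; omega

theorem runs_multiply {N : ℕ} (i : List (Option Bool)) (c : ℕ) :
    multiply.Runs (store i (ones N) (ones c) [] [] [] [] []) (c * (7 * N + 8) + 2)
      (store i (ones N) (ones (c * (N + 1))) [] [] [] [] []) := by
  have h₁ := runs_move (s := Stk.rep) (t := Stk.cnt) (by decide) (A := Option.isSome) (r := [])
    rfl (l := ones c) (a := store i (ones N) (ones c) [] [] [] [] []) (by simp) fun x _ => rfl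
  have h₂ := runs_drain_multiply (N := N) i c 0
  simp only [reverse_ones, store_cnt, update_rep, update_cnt, List.append_nil] at h₁
  refine (cast (congrArg _ ?_) (h₁.seq h₂)).mono ?_
  · simp
  · simp only [length_ones]; nlinarith

theorem runs_rep_multiply {B N : ℕ} (i : List (Option Bool)) (a : ℕ) (hB : (N + 1) ^ a ≤ B)
    (hN : N ≤ B) :
    (StackFlow.rep a multiply).Runs (store i (ones N) (ones 1) [] [] [] [] [])
      (a * (10 * (B + 1) ^ 2) + 1) (store i (ones N) (ones ((N + 1) ^ a)) [] [] [] [] []) := by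
  refine Runs.rep (fun j => store i (ones N) (ones ((N + 1) ^ j)) [] [] [] [] []) fun j hj => ?_
  have h := runs_multiply (N := N) i ((N + 1) ^ j)
  rw [← pow_succ] at h
  refine h.mono ?_
  have h₁ : (N + 1) ^ j ≤ B := (Nat.pow_le_pow_right (by omega) hj.le).trans hB
  have h₂ : (N + 1) ^ j * (7 * N + 8) ≤ B * (7 * B + 8) := Nat.mul_le_mul h₁ (by omega)
  nlinarith

theorem runs_drain_copy {N : ℕ} (i : List (Option Bool)) : ∀ (c V : ℕ),
    (drain .rep Option.isSome fun _ => copy .num .inp .tmp).Runs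
      (store (ones V ++ i) (ones N) (ones c) [] [] [] [] []) (c * (7 * N + 4) + 1)
      (store (ones (V + c * N) ++ i) (ones N) [] [] [] [] [] [])
  | 0, V => by
    simpa using runs_drain_of_false (by rfl)
  | c + 1, V => by
    have h₁ := runs_copy (s := .num) (t := .inp) (u := .tmp) (by decide) (by decide) (by decide)
      (a := store (ones V ++ i) (ones N) (ones c) [] [] [] [] []) rfl
    simp only [store_num, store_inp, update_inp] at h₁
    rw [← List.append_assoc, ← ones_add] at h₁
    have h₃ := Runs.drain (s := Stk.rep) (A := Option.isSome)
      (M := fun _ : Option Bool => copy Stk.num .inp .tmp)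
      (a := store (ones V ++ i) (ones N) (ones (c + 1)) [] [] [] [] []) (x := some true)
      (l := ones c) (by simp [ones, List.replicate_succ]) rfl (by simpa using h₁)
      (runs_drain_copy i c (N + V))
    refine (cast (congrArg _ ?_) h₃).mono ?_
    · rw [show N + V + c * N = V + (c + 1) * N by ring]
    · simp only [Nat.succ_mul]; omega

/-- The word is built from its end: the separator goes onto the clauses first, then `c` blocks of
`N` digits on top. -/
theorem runs_writeNum {N : ℕ} (i : List (Option Bool)) (c : ℕ) :
    writeNum.Runs (store i (ones N) (ones c) [] [] [] [] []) (c * (7 * N + 4) + 3 * N + 3)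
      (store (BoolCSP.unary (N * c) ++ i) [] [] [] [] [] [] []) := by
  have h₁ := runs_push .inp none (store i (ones N) (ones c) [] [] [] [] [])
  have h₂ := runs_drain_copy (N := N) (none :: i) c 0
  have h₃ := runs_clear Stk.num (a := store (ones (0 + c * N) ++ none :: i) (ones N) []
    [] [] [] [] []) rfl
  simp only [store_inp, update_inp, update_num] at h₁ h₃
  refine (cast (congrArg _ ?_) (h₁.seq (h₂.seq h₃))).mono ?_
  · simp [unary_eq, mul_comm]
  · simp only [store_num, length_ones]; omega

/-- The program computes the words obtained by rotating all clauses `k` times. -/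
theorem runs_blowUpFlow {B N k a : ℕ} (D : ℕ → List (List (Option Bool) × List ℕ))
    (hsucc : ∀ j < k, D (j + 1) = (D j).flatMap (rotated N ((N + 1) ^ a)))
    (hD : ∀ j < k, ∀ d ∈ D j, d.1.length = 2 ^ k ∧ d.2.length = k ∧
      (clauseWord d).length + N * (N + 1) ^ a ≤ B)
    (hl : ∀ j < k, (D j).length ≤ B) (hl' : ∀ j ≤ k, ((D j).flatMap clauseWord).length ≤ B)
    (hN : N ≤ B) (hR : (N + 1) ^ a ≤ B) :
    (blowUpFlow k a).Runs
      (Function.update (fun _ => []) Stk.inp (BoolCSP.unary N ++ (D 0).flatMap clauseWord))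
      ((a + k + 1) * (40 * (B + 1) ^ 3) + 10)
      (Function.update (fun _ => []) Stk.inp
        (BoolCSP.unary (N * (N + 1) ^ a) ++ (D k).flatMap clauseWord)) := by
  have e : (fun _ => [] : Stk → List (Option Bool)) = store [] [] [] [] [] [] [] [] := by
    funext s; cases s <;> rfl
  rw [e, update_inp, update_inp]
  have h₁ := runs_readNum (s := .inp) (t := .num) (by decide) (m := N) (r := (D 0).flatMap clauseWord)
    (a := store (BoolCSP.unary N ++ (D 0).flatMap clauseWord) [] [] [] [] [] [] []) rfl
  have h₂ := runs_push .rep (some true)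
    (store ((D 0).flatMap clauseWord) (ones N) [] [] [] [] [] [])
  simp only [store_num, store_rep, update_inp, update_num, update_rep, List.append_nil] at h₁ h₂
  have h₃ := runs_rep_multiply (B := B) (N := N) ((D 0).flatMap clauseWord) a hR hN
  have h₄ := Runs.rep (M := rotateAll k) (m := k) (t := 40 * (B + 1) ^ 3)
    (fun j => store ((D j).flatMap clauseWord) (ones N) (ones ((N + 1) ^ a)) [] [] [] [] [])
    fun j hj => by
      have hj' := hl' (j + 1) hj
      rw [hsucc j hj] at hj' ⊢
      exact runs_rotateAll (by omega) hN hR (D j) (hD j hj) (hl j hj) hj'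
  have h₅ := runs_writeNum (N := N) ((D k).flatMap clauseWord) ((N + 1) ^ a)
  refine (h₁.seq (h₂.seq (h₃.seq (h₄.seq h₅)))).mono ?_
  have h₆ : (N + 1) ^ a * (7 * N + 4) ≤ B * (7 * B + 4) := Nat.mul_le_mul hR (by omega)
  have h₇ : a * (10 * (B + 1) ^ 2) ≤ a * (40 * (B + 1) ^ 3) := by
    refine Nat.mul_le_mul_left _ ?_
    nlinarith [Nat.zero_le (B ^ 2), Nat.zero_le (B ^ 3)]
  nlinarith [Nat.zero_le (B ^ 2), Nat.zero_le (B ^ 3)]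

end StackFlow

namespace BoolCSP

/-! ### The blow-up of an instance -/

/-- All `k`-tuples of elements of `Fin R`, in lexicographic order. -/
def allTuples (R : ℕ) : (k : ℕ) → List (Fin k → Fin R)
  | 0 => [Fin.elim0]
  | k + 1 => (allTuples R k).flatMap fun t =>
      (List.finRange R).map fun j => Fin.snoc (α := fun _ => Fin R) t j

theorem length_allTuples (R : ℕ) : ∀ k, (allTuples R k).length = R ^ k
  | 0 => rfl
  | k + 1 => by simp [allTuples, length_allTuples R k, pow_succ]

theorem mem_allTuples {R : ℕ} : ∀ {k : ℕ} (t : Fin k → Fin R), t ∈ allTuples R k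
  | 0, t => by
    rw [Subsingleton.elim t Fin.elim0]
    exact List.mem_singleton_self _
  | k + 1, t => by
    simp only [allTuples, List.mem_flatMap, List.mem_map, List.mem_finRange, true_and]
    exact ⟨Fin.init t, mem_allTuples _, t (Fin.last k), Fin.snoc_init_self t⟩

theorem nodup_allTuples (R : ℕ) : ∀ k, (allTuples R k).Nodup
  | 0 => List.nodup_singleton _
  | k + 1 => by
    refine List.nodup_flatMap.2 ⟨fun t _ => ?_, (nodup_allTuples R k).imp fun {t u} htu => ?_⟩
    · refine (List.nodup_finRange R).map fun i j h => ?_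
      simpa using congrFun h (Fin.last k)
    · intro f hf hf'
      simp only [List.mem_map, List.mem_finRange, true_and] at hf hf'
      obtain ⟨i, rfl⟩ := hf
      obtain ⟨j, hj⟩ := hf'
      exact htu (by simpa using (congrArg (Fin.init (α := fun _ => Fin R)) hj).symm)

/-- The clause obtained by replacing the `i`-th variable of `C` by its copy number `t i`. -/
def copyClause {k n R : ℕ} (C : BoolClause k n) (t : Fin k → Fin R) : BoolClause k (R * n) where
  pred := C.pred
  scope := ⟨fun i => finProdFinEquiv (t i, C.scope i), fun i j h => by
    simpa using (Prod.ext_iff.1 (finProdFinEquiv.injective h)).2⟩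

/-- The `R`-blow-up of an instance. The copy number `j` of the variable `v` has index
`v + n * j`, where `n` is the number of variables. -/
def blowUp {k : ℕ} (R : ℕ) (Φ : BoolCSP k) : BoolCSP k where
  numVars := R * Φ.numVars
  clauses := Φ.clauses.flatMap fun C => (allTuples R k).map (copyClause C)

/-- The clauses of the blow-up after the copies of the first `j` variables have been chosen. -/
def partialBlowUp {k : ℕ} (R : ℕ) (Φ : BoolCSP k) (j : ℕ) : List (List (Option Bool) × List ℕ) :=
  Φ.clauses.flatMap fun C => (allTuples R j).map fun t =>
    (truthTable C.pred, (List.ofFn fun i => (C.scope i : ℕ)).drop j ++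
      List.ofFn fun i : Fin j =>
        (List.ofFn fun i => (C.scope i : ℕ)).getD i 0 + Φ.numVars * (t i : ℕ))

open StackFlow

/-- `allTuples` appends the new coordinate at the end and lets it vary fastest, exactly as a
rotation appends the copies of the leading variable. The lists therefore agree including their
order, as equality of words demands. -/
theorem partialBlowUp_succ {k : ℕ} (R : ℕ) (Φ : BoolCSP k) {j : ℕ} (hj : j < k) :
    partialBlowUp R Φ (j + 1) = (partialBlowUp R Φ j).flatMap (rotated Φ.numVars R) := by
  simp only [partialBlowUp, List.flatMap_assoc, List.flatMap_map, allTuples, List.map_flatMap,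
    List.map_map]
  congr 1
  funext C
  congr 1
  funext t
  generalize hvs : (List.ofFn fun i => (C.scope i : ℕ)) = vs
  have hl : j < vs.length := by simpa [← hvs] using hj
  rw [List.drop_eq_getElem_cons hl, List.cons_append]
  simp only [rotated, ← List.map_coe_finRange_eq_range, List.map_map]
  congr 1
  funext x
  dsimp only [Function.comp_apply]
  rw [List.ofFn_succ', List.concat_eq_append]
  simp [hl]

theorem flatMap_partialBlowUp_zero {k : ℕ} (R : ℕ) (Φ : BoolCSP k) :
    (partialBlowUp R Φ 0).flatMap clauseWord = Φ.clauses.flatMap encodeClause := by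
  simp only [partialBlowUp, allTuples, List.flatMap_assoc]
  congr 1
  funext C
  simp [clauseWord, encodeClause, List.ofFn_eq_map, List.flatMap_map]

theorem flatMap_partialBlowUp_self {k : ℕ} (R : ℕ) (Φ : BoolCSP k) :
    (partialBlowUp R Φ k).flatMap clauseWord = (Φ.blowUp R).clauses.flatMap encodeClause := by
  simp only [partialBlowUp, blowUp, List.flatMap_assoc, List.flatMap_map]
  congr 1
  funext C
  congr 1
  funext t
  rw [List.drop_of_length_le (by simp)]
  simp [clauseWord, encodeClause, List.ofFn_eq_map, List.flatMap_map, copyClause,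
    finProdFinEquiv]

/-! ### Size bounds and polynomial time -/

theorem length_partialBlowUp {k : ℕ} (R : ℕ) (Φ : BoolCSP k) (j : ℕ) :
    (partialBlowUp R Φ j).length = Φ.clauses.length * R ^ j := by
  simp [partialBlowUp, length_allTuples]

theorem length_flatMap_unary_le {M : ℕ} (vs : List ℕ) (h : ∀ v ∈ vs, v < M) :
    (vs.flatMap unary).length ≤ vs.length * M := by
  induction vs with
  | nil => simp
  | cons v vs ih =>
    have h₁ := ih fun u hu => h u (List.mem_cons_of_mem _ hu)
    have h₂ := h v List.mem_cons_self
    rw [List.flatMap_cons, List.length_append, List.length_cons, Nat.succ_mul]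
    simp only [unary, List.length_append, List.length_replicate, List.length_singleton]
    omega

/-- A copy has index at most `(n - 1) + n * (R - 1)`, and a variable not yet replaced has index
below `n ≤ n * R`. So each of the `k` unary words has length at most `n * R`. -/
theorem of_mem_partialBlowUp {k R : ℕ} (hR : 0 < R) {Φ : BoolCSP k} {j : ℕ} (hj : j ≤ k)
    {d : List (Option Bool) × List ℕ} (hd : d ∈ partialBlowUp R Φ j) :
    d.1.length = 2 ^ k ∧ d.2.length = k ∧
      (clauseWord d).length ≤ 2 ^ k + k * (Φ.numVars * R) := by
  simp only [partialBlowUp, List.mem_flatMap, List.mem_map] at hd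
  obtain ⟨C, _, t, _, rfl⟩ := hd
  have h₁ : (truthTable C.pred).length = 2 ^ k := by simp [truthTable]
  generalize hvs : (List.ofFn fun i => (C.scope i : ℕ)) = vs
  have hl : vs.length = k := by simp [← hvs]
  have hn : ∀ v ∈ vs, v < Φ.numVars := by
    rw [← hvs]
    intro v hv
    obtain ⟨i, rfl⟩ := (List.mem_ofFn' _ _).1 hv
    exact (C.scope i).2
  have h₂ : (vs.drop j ++ List.ofFn fun i : Fin j =>
      vs.getD i 0 + Φ.numVars * (t i : ℕ)).length = k := by
    simp [hl]; omega
  refine ⟨h₁, h₂, ?_⟩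
  have h₃ := length_flatMap_unary_le (M := Φ.numVars * R) (vs.drop j ++ List.ofFn fun i : Fin j =>
      vs.getD i 0 + Φ.numVars * (t i : ℕ)) fun v hv => by
    rcases List.mem_append.1 hv with hv | hv
    · exact (hn v (List.mem_of_mem_drop hv)).trans_le (Nat.le_mul_of_pos_right _ hR)
    · obtain ⟨i, rfl⟩ := (List.mem_ofFn' _ _).1 hv
      have hi : (i : ℕ) < vs.length := by omega
      have h₄ : vs.getD i 0 < Φ.numVars := by
        rw [List.getD_eq_getElem _ _ hi]
        exact hn _ (List.getElem_mem hi)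
      calc vs.getD i 0 + Φ.numVars * (t i : ℕ) < Φ.numVars + Φ.numVars * (t i : ℕ) := by omega
        _ = Φ.numVars * (t i + 1) := by ring
        _ ≤ Φ.numVars * R := Nat.mul_le_mul_left _ (t i).2
  rw [h₂] at h₃
  simp only [clauseWord, List.length_append, h₁] at h₃ ⊢
  omega

theorem length_flatMap_le {α β : Type} {M : ℕ} (l : List α) (f : α → List β)
    (h : ∀ x ∈ l, (f x).length ≤ M) : (l.flatMap f).length ≤ l.length * M := by
  induction l with
  | nil => simp
  | cons x l ih =>
    have h₁ := ih fun u hu => h u (List.mem_cons_of_mem _ hu)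
    have h₂ := h x List.mem_cons_self
    rw [List.flatMap_cons, List.length_append, List.length_cons, Nat.succ_mul]
    omega

theorem length_le_length_flatMap {α β : Type} (l : List α) (f : α → List β)
    (h : ∀ x, 0 < (f x).length) : l.length ≤ (l.flatMap f).length := by
  induction l with
  | nil => simp
  | cons x l ih =>
    have := h x
    rw [List.flatMap_cons, List.length_append, List.length_cons]
    omega

/-- The `(n + 1) ^ a`-blow-up, with `n` the number of variables, can be computed in polynomial
time. -/
theorem polyTime_blowUp (k a : ℕ) :
    PolyTime fun Φ : BoolCSP k => Φ.blowUp ((Φ.numVars + 1) ^ a) := by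
  -- The first factor bounds the number of clauses at every stage, at most `L * R ^ k`. The second
  -- bounds the word of one clause plus `N * R`. Their product bounds the whole clause list.
  let P : Polynomial ℕ := (Polynomial.X + 1) ^ (a * k + 1) *
    (Polynomial.C (2 ^ k) + Polynomial.C (k + 1) * (Polynomial.X + 1) ^ (a + 1))
  refine nonempty_polyTime (blowUpFlow k a) Stk.inp
    (Polynomial.C (a + k + 1) * (Polynomial.C 40 * (P + 1) ^ 3) + Polynomial.C 10) fun Φ => ?_
  set L := (encode Φ).length with hL
  set N := Φ.numVars with hN
  set R := (N + 1) ^ a with hR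
  have hR0 : 0 < R := Nat.pow_pos (by omega)
  have hlen : N + 1 + (Φ.clauses.flatMap encodeClause).length = L := by
    simp only [hL, encode, unary, List.length_append, List.length_replicate, List.length_singleton, hN]
  have hm : Φ.clauses.length ≤ L := by
    have := length_le_length_flatMap Φ.clauses encodeClause fun C => by
      have := Nat.two_pow_pos k
      simp only [encodeClause, truthTable, List.length_append, List.length_map, List.length_range]
      omega
    omega
  have hRL : R ≤ (L + 1) ^ a := Nat.pow_le_pow_left (by omega) a
  have hNR : N * R ≤ (L + 1) ^ (a + 1) := by
    rw [pow_succ, mul_comm]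
    exact Nat.mul_le_mul hRL (by omega)
  set B := P.eval L with hB
  have hB' : B = (L + 1) ^ (a * k + 1) * (2 ^ k + (k + 1) * (L + 1) ^ (a + 1)) := by
    simp [hB, P]
  have hk1 : 1 ≤ 2 ^ k := Nat.one_le_two_pow
  have hL1 : 1 ≤ (L + 1) ^ (a * k + 1) := Nat.one_le_pow _ _ (by omega)
  have hL2 : 1 ≤ (L + 1) ^ (a + 1) := Nat.one_le_pow _ _ (by omega)
  have hB₁ : 2 ^ k + (k + 1) * (L + 1) ^ (a + 1) ≤ B := by
    rw [hB']; exact Nat.le_mul_of_pos_left _ hL1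
  have hB₂ : (L + 1) ^ (a + 1) ≤ B := by
    refine le_trans ?_ hB₁
    nlinarith
  have hDl : ∀ j ≤ k, (partialBlowUp R Φ j).length ≤ (L + 1) ^ (a * k + 1) := fun j hj => by
    rw [length_partialBlowUp, pow_succ, mul_comm, pow_mul]
    refine Nat.mul_le_mul ?_ (by omega)
    exact (Nat.pow_le_pow_right hR0 hj).trans (Nat.pow_le_pow_left hRL k)
  have hw : ∀ j ≤ k, ∀ d ∈ partialBlowUp R Φ j, (clauseWord d).length ≤
      2 ^ k + k * (L + 1) ^ (a + 1) := fun j hj d hd =>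
    (of_mem_partialBlowUp hR0 hj hd).2.2.trans
      (Nat.add_le_add_left (Nat.mul_le_mul_left _ hNR) _)
  have key := runs_blowUpFlow (B := B) (N := N) (k := k) (a := a) (partialBlowUp R Φ)
    (fun j hj => partialBlowUp_succ R Φ hj)
    (fun j hj d hd => by
      obtain ⟨h₁, h₂, _⟩ := of_mem_partialBlowUp hR0 hj.le hd
      refine ⟨h₁, h₂, ?_⟩
      have h₃ := hw j hj.le d hd
      rw [Nat.succ_mul] at hB₁
      rw [← hR]
      omega)
    (fun j hj => (hDl j hj.le).trans (by
      rw [hB']; exact Nat.le_mul_of_pos_right _ (by omega)))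
    (fun j hj => by
      refine (length_flatMap_le _ _ (hw j hj)).trans ?_
      rw [hB']
      exact Nat.mul_le_mul (hDl j hj) (by rw [Nat.succ_mul]; omega))
    (by
      refine le_trans ?_ hB₂
      rw [pow_succ]
      exact (show N ≤ L + 1 by omega).trans (Nat.le_mul_of_pos_left _ (Nat.pow_pos (by omega))))
    (by
      refine le_trans (hRL.trans ?_) hB₂
      exact Nat.pow_le_pow_right (by omega) (by omega))
  rw [flatMap_partialBlowUp_zero, flatMap_partialBlowUp_self] at key
  have e₂ : encode (Φ.blowUp R) =
      unary (N * (N + 1) ^ a) ++ (Φ.blowUp R).clauses.flatMap encodeClause := by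
    rw [encode, ← hR, mul_comm N R]; rfl
  refine (cast ?_ key : _)
  rw [e₂]
  simp [encode, ← hN, ← hB]

end BoolCSP

namespace BoolCSP

/-! ### The value of a blow-up -/

variable {k : ℕ}

theorem copyClause_inj {n R : ℕ} {C C' : BoolClause k n} {t t' : Fin k → Fin R}
    (h : copyClause C t = copyClause C' t') : C = C' ∧ t = t' := by
  have hs : ∀ i, (t i, C.scope i) = (t' i, C'.scope i) := fun i =>
    finProdFinEquiv.injective (congrArg (fun D => D.scope i) h)
  refine ⟨BoolClause.ext (congrArg (fun D => D.pred) h : _) ?_, ?_⟩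
  · ext i
    exact congrArg (fun x => (x.2 : ℕ)) (hs i)
  · funext i
    exact congrArg Prod.fst (hs i)

theorem mem_blowUp {R : ℕ} {Φ : BoolCSP k} {D : BoolClause k (R * Φ.numVars)} :
    D ∈ (Φ.blowUp R).clauses ↔ ∃ C ∈ Φ.clauses, ∃ t, copyClause C t = D := by
  refine List.mem_flatMap.trans ?_
  simp only [List.mem_map, mem_allTuples, true_and]

theorem IsSimple.blowUp {Φ : BoolCSP k} (h : Φ.IsSimple) (R : ℕ) : (Φ.blowUp R).IsSimple := by
  refine List.nodup_flatMap.2 ⟨fun C _ => ?_, List.Pairwise.imp (fun {C C'} hC => ?_) h⟩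
  · exact (nodup_allTuples R k).map fun t t' h => (copyClause_inj h).2
  · intro D hD hD'
    obtain ⟨t, _, rfl⟩ := List.mem_map.1 hD
    obtain ⟨t', _, h'⟩ := List.mem_map.1 hD'
    exact hC (copyClause_inj h').1.symm

theorem copy_injective {n R : ℕ} (v : Fin n) :
    Function.Injective fun j : Fin R => finProdFinEquiv (j, v) :=
  fun _ _ h => congrArg Prod.fst (finProdFinEquiv.injective h)

theorem isBlowUp_blowUp (R : ℕ) (Φ : BoolCSP k) : IsBlowUp R Φ (Φ.blowUp R) := by
  refine ⟨fun w => (finProdFinEquiv.symm w).2, fun v => ?_, fun D => ?_⟩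
  · change (Finset.univ.filter fun w : Fin (R * Φ.numVars) => (finProdFinEquiv.symm w).2 = v).card = R
    have : (Finset.univ.filter fun w : Fin (R * Φ.numVars) => (finProdFinEquiv.symm w).2 = v) =
        Finset.univ.map ⟨fun j : Fin R => finProdFinEquiv (j, v), copy_injective v⟩ := by
      ext w
      simp only [Finset.mem_filter, Finset.mem_univ, true_and, Finset.mem_map,
        Function.Embedding.coeFn_mk]
      constructor
      · rintro rfl
        exact ⟨(finProdFinEquiv.symm w).1, by simp only [Prod.mk.eta, Equiv.apply_symm_apply]⟩
      · rintro ⟨j, rfl⟩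
        rw [Equiv.symm_apply_apply]
    rw [this]
    simp
  · refine mem_blowUp.trans ?_
    constructor
    · rintro ⟨C, hC, t, rfl⟩
      refine ⟨C, hC, rfl, fun i => ?_⟩
      change _ = (finProdFinEquiv.symm (finProdFinEquiv (t i, C.scope i))).2
      rw [Equiv.symm_apply_apply]
    · rintro ⟨C, hC, hp, hs⟩
      refine ⟨C, hC, fun i => (finProdFinEquiv.symm (D.scope i)).1, BoolClause.ext hp ?_⟩
      refine Function.Embedding.ext fun i => ?_
      change finProdFinEquiv ((finProdFinEquiv.symm (D.scope i)).1, C.scope i) = D.scope i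
      rw [hs i]
      exact finProdFinEquiv.apply_symm_apply _

theorem predicates_blowUp {R : ℕ} (hR : 0 < R) (Φ : BoolCSP k) :
    (Φ.blowUp R).predicates = Φ.predicates := by
  ext f
  constructor
  · rintro ⟨D, hD, rfl⟩
    obtain ⟨C, hC, t, rfl⟩ := mem_blowUp.1 hD
    exact ⟨C, hC, rfl⟩
  · rintro ⟨C, hC, rfl⟩
    exact ⟨_, mem_blowUp.2 ⟨C, hC, fun _ => ⟨0, hR⟩, rfl⟩, rfl⟩

theorem length_blowUp (R : ℕ) (Φ : BoolCSP k) :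
    (Φ.blowUp R).clauses.length = Φ.clauses.length * R ^ k := by
  simp [blowUp, length_allTuples]

/-- The number of clauses that an assignment satisfies. -/
def numSat (Φ : BoolCSP k) (σ : Fin Φ.numVars → Bool) : ℕ := Φ.clauses.countP fun C => C.sat σ

theorem numSat_le (Φ : BoolCSP k) (σ : Fin Φ.numVars → Bool) : Φ.numSat σ ≤ Φ.clauses.length :=
  List.countP_le_length

theorem valOf_of_nil {Φ : BoolCSP k} (h : Φ.clauses = []) (σ : Fin Φ.numVars → Bool) :
    Φ.valOf σ = 1 := if_pos h

theorem valOf_of_ne_nil {Φ : BoolCSP k} (h : Φ.clauses ≠ []) (σ : Fin Φ.numVars → Bool) :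
    Φ.valOf σ = (Φ.numSat σ : ℝ) / Φ.clauses.length := if_neg h

theorem valOf_le_val (Φ : BoolCSP k) (σ : Fin Φ.numVars → Bool) : Φ.valOf σ ≤ Φ.val :=
  Finset.le_sup' Φ.valOf (Finset.mem_univ σ)

theorem exists_valOf_eq_val (Φ : BoolCSP k) : ∃ σ, Φ.valOf σ = Φ.val := by
  obtain ⟨σ, _, h⟩ := Finset.exists_mem_eq_sup' Finset.univ_nonempty Φ.valOf
  exact ⟨σ, h.symm⟩

theorem val_le {Φ : BoolCSP k} {x : ℝ} (h : ∀ σ, Φ.valOf σ ≤ x) : Φ.val ≤ x :=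
  Finset.sup'_le _ _ fun σ _ => h σ

theorem val_of_nil {Φ : BoolCSP k} (h : Φ.clauses = []) : Φ.val = 1 := by
  obtain ⟨σ, hσ⟩ := Φ.exists_valOf_eq_val
  rw [← hσ, valOf_of_nil h]

theorem valOf_le_one (Φ : BoolCSP k) (σ : Fin Φ.numVars → Bool) : Φ.valOf σ ≤ 1 := by
  by_cases h : Φ.clauses = []
  · rw [valOf_of_nil h]
  · rw [valOf_of_ne_nil h]
    exact div_le_one_of_le₀ (by exact_mod_cast Φ.numSat_le σ) (Nat.cast_nonneg _)

theorem valOf_eq_one_iff {Φ : BoolCSP k} {σ : Fin Φ.numVars → Bool} :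
    Φ.valOf σ = 1 ↔ ∀ C ∈ Φ.clauses, C.sat σ = true := by
  by_cases h : Φ.clauses = []
  · simp [valOf_of_nil h, h]
  · have h' : (Φ.clauses.length : ℝ) ≠ 0 := by simpa using h
    rw [valOf_of_ne_nil h, div_eq_one_iff_eq h', Nat.cast_inj, numSat, List.countP_eq_length]

/-- Deleting clauses from a satisfiable instance leaves it satisfiable. -/
theorem val_keep_eq_one {Φ : BoolCSP k} (h : Φ.val = 1) (S : Set (Fin Φ.clauses.length)) :
    (Φ.keep S).val = 1 := by
  obtain ⟨σ, hσ⟩ := Φ.exists_valOf_eq_val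
  rw [h, valOf_eq_one_iff] at hσ
  refine le_antisymm (val_le (valOf_le_one _)) ?_
  refine le_of_eq_of_le (valOf_eq_one_iff (Φ := Φ.keep S) (σ := σ) |>.2 ?_).symm (valOf_le_val (Φ.keep S) σ)
  intro C hC
  obtain ⟨i, _, rfl⟩ := List.mem_map.1 hC
  exact hσ _ (List.get_mem _ _)

theorem sum_map_allTuples {R : ℕ} (f : (Fin k → Fin R) → ℕ) :
    ((allTuples R k).map f).sum = ∑ t, f t := by
  rw [← List.sum_toFinset f (nodup_allTuples R k)]
  congr 1
  ext t
  simp [mem_allTuples]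

theorem numSat_blowUp (R : ℕ) (Φ : BoolCSP k) (τ : Fin (R * Φ.numVars) → Bool) :
    (Φ.blowUp R).numSat τ = (Φ.clauses.map fun C =>
      ∑ t : Fin k → Fin R, if (copyClause C t).sat τ then 1 else 0).sum := by
  simp only [numSat, blowUp, List.countP_flatMap]
  congr 2
  funext C
  rw [← sum_map_allTuples, Function.comp_apply, List.countP_map]
  generalize allTuples R k = l
  induction l with
  | nil => rfl
  | cons t l ih =>
    rw [List.countP_cons, List.map_cons, List.sum_cons, ih, add_comm]
    rfl

theorem numSat_eq_sum (Φ : BoolCSP k) (σ : Fin Φ.numVars → Bool) :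
    Φ.numSat σ = (Φ.clauses.map fun C => if C.sat σ then 1 else 0).sum := by
  rw [numSat]
  generalize Φ.clauses = l
  induction l with
  | nil => rfl
  | cons t l ih => rw [List.countP_cons, List.map_cons, List.sum_cons, ih, add_comm]

/-- Each `t` extends to `R ^ (n - k)` choices `s`, because the values outside the range of `e` are
free. Injectivity of `e`, that is, distinctness of the variables of a clause, is what makes the
restriction uniform. -/
theorem sum_comp_embedding {n R : ℕ} (e : Fin k ↪ Fin n) (g : (Fin k → Fin R) → ℕ) :
    R ^ k * ∑ s : Fin n → Fin R, g (fun i => s (e i)) = R ^ n * ∑ t, g t := by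
  classical
  let E := Equiv.piEquivPiSubtypeProd (fun x => x ∈ Set.range e) fun _ => Fin R
  let F : ({x // x ∈ Set.range e} → Fin R) ≃ (Fin k → Fin R) :=
    Equiv.arrowCongr (Equiv.ofInjective e e.injective).symm (Equiv.refl _)
  have h₁ : ∑ s : Fin n → Fin R, g (fun i => s (e i)) =
      ∑ x : (Fin k → Fin R) × ({x // x ∉ Set.range e} → Fin R), g x.1 := by
    refine Fintype.sum_equiv (E.trans (Equiv.prodCongr F (Equiv.refl _))) _ _ fun s => ?_
    rfl
  have h₂ : Fintype.card {x // x ∉ Set.range e} = n - k := by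
    rw [Fintype.card_subtype_compl]
    have : Fintype.card {x // x ∈ Set.range e} = k := by
      rw [← Fintype.card_congr (Equiv.ofInjective e e.injective), Fintype.card_fin]
    rw [this, Fintype.card_fin]
  have hk : k ≤ n := by simpa using Fintype.card_le_of_embedding e
  rw [h₁, Fintype.sum_prod_type]
  simp only [Finset.sum_const, Finset.card_univ, Fintype.card_fun, Fintype.card_fin, h₂,
    smul_eq_mul, ← Finset.mul_sum]
  rw [← mul_assoc, ← pow_add, Nat.add_sub_cancel' hk]

/-- The number of satisfied clauses of a blow-up is the average, over all choices of one copy of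
each variable, of the number of satisfied clauses of the instance. -/
theorem sum_numSat (R : ℕ) (Φ : BoolCSP k) (τ : Fin (R * Φ.numVars) → Bool) :
    R ^ k * ∑ s : Fin Φ.numVars → Fin R, Φ.numSat (fun v => τ (finProdFinEquiv (s v, v))) =
      R ^ Φ.numVars * (Φ.blowUp R).numSat τ := by
  rw [numSat_blowUp]
  simp only [numSat_eq_sum]
  generalize Φ.clauses = l
  induction l with
  | nil => simp
  | cons C l ih =>
    simp only [List.map_cons, List.sum_cons, Finset.sum_add_distrib, mul_add, ih]
    congr 1
    exact sum_comp_embedding C.scope fun t => if (copyClause C t).sat τ then 1 else 0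

/-- Both inequalities come from `sum_numSat`: an average is at most the maximum, and for an
assignment constant on the copies of each variable all averaged terms coincide. -/
theorem val_blowUp {R : ℕ} (hR : 0 < R) (Φ : BoolCSP k) : (Φ.blowUp R).val = Φ.val := by
  by_cases h : Φ.clauses = []
  · rw [val_of_nil h, val_of_nil (by simp [blowUp, h])]
  have hlen := length_blowUp R Φ
  have hm : 0 < Φ.clauses.length := List.length_pos_iff.2 h
  have h' : (Φ.blowUp R).clauses ≠ [] := by
    rw [← List.length_pos_iff, hlen]; positivity
  have hmR : (0 : ℝ) < Φ.clauses.length := by exact_mod_cast hm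
  have hRR : (0 : ℝ) < R := by exact_mod_cast hR
  apply le_antisymm
  · refine val_le fun τ => ?_
    rw [valOf_of_ne_nil h', hlen, div_le_iff₀ (by positivity)]
    have h₁ : ∀ σ, (Φ.numSat σ : ℝ) ≤ Φ.val * Φ.clauses.length := fun σ => by
      have := Φ.valOf_le_val σ
      rwa [valOf_of_ne_nil h, div_le_iff₀ hmR] at this
    have h₂ : (R : ℝ) ^ k * ∑ s : Fin Φ.numVars → Fin R,
        (Φ.numSat (fun v => τ (finProdFinEquiv (s v, v))) : ℝ) =
        (R : ℝ) ^ Φ.numVars * (Φ.blowUp R).numSat τ := by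
      exact_mod_cast sum_numSat R Φ τ
    have h₃ : ∑ s : Fin Φ.numVars → Fin R,
        (Φ.numSat (fun v => τ (finProdFinEquiv (s v, v))) : ℝ) ≤
        (R : ℝ) ^ Φ.numVars * (Φ.val * Φ.clauses.length) := by
      refine (Finset.sum_le_sum fun s _ => h₁ _).trans (le_of_eq ?_)
      simp
    have h₄ : (R : ℝ) ^ Φ.numVars * (Φ.blowUp R).numSat τ ≤
        (R : ℝ) ^ Φ.numVars * (Φ.val * Φ.clauses.length * R ^ k) := by
      rw [← h₂]
      calc _ ≤ (R : ℝ) ^ k * ((R : ℝ) ^ Φ.numVars * (Φ.val * Φ.clauses.length)) := by gcongr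
        _ = _ := by ring
    have h₅ := le_of_mul_le_mul_left h₄ (by positivity)
    push_cast
    linarith
  · obtain ⟨σ, hσ⟩ := Φ.exists_valOf_eq_val
    rw [← hσ]
    refine le_of_eq_of_le ?_
      (valOf_le_val (Φ.blowUp R) fun w : Fin (R * Φ.numVars) => σ (finProdFinEquiv.symm w).2)
    have h₁ := sum_numSat R Φ fun w : Fin (R * Φ.numVars) => σ (finProdFinEquiv.symm w).2
    simp only [Equiv.symm_apply_apply, Finset.sum_const, Finset.card_univ, Fintype.card_fun,
      Fintype.card_fin, smul_eq_mul] at h₁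
    rw [mul_left_comm] at h₁
    have h₂ := Nat.eq_of_mul_eq_mul_left (by positivity) h₁
    refine (valOf_of_ne_nil h σ).trans (Eq.trans ?_ (valOf_of_ne_nil h' _).symm)
    rw [← h₂, hlen]
    push_cast
    field_simp

end BoolCSP

/-! ### Concentration of Bernoulli random sets -/

section Chernoff

open MeasureTheory ProbabilityTheory Finset

variable {ι : Type*} [Fintype ι] [DecidableEq ι]

open Classical in
/-- The exponential moments of a weighted Bernoulli random set. -/
theorem sum_setBernoulli_mul_prod (p : unitInterval) (x : ι → ℝ) :
    ∑ S : Set ι, (setBernoulli Set.univ p).real {S} * ∏ i, (if i ∈ S then x i else 1) =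
      ∏ i, ((p : ℝ) * x i + (1 - p)) := by
  -- Expanding the product of sums gives a sum over subsets, which are matched with the outcomes
  -- `S`.
  rw [Finset.prod_add, Finset.powerset_univ]
  refine (Fintype.sum_equiv Fintype.finsetEquivSet _ _ fun t => ?_).symm
  have h₁ : (Fintype.finsetEquivSet t : Set ι) = (t : Set ι) := rfl
  rw [h₁, setBernoulli_real_singleton p (Set.subset_univ _) Set.finite_univ, Set.ncard_coe_finset]
  have h₂ : (Set.univ \ (t : Set ι)).ncard = (univ \ t).card := by
    rw [← Set.ncard_coe_finset, Finset.coe_sdiff, Finset.coe_univ]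
  rw [h₂, Finset.prod_mul_distrib, Finset.prod_const, Finset.prod_const]
  simp only [Finset.mem_coe, Finset.prod_ite_mem, Finset.univ_inter]
  ring

open Classical in
/-- Markov's inequality for the exponential of a weight of a Bernoulli random set. -/
theorem setBernoulli_real_le_exp_mul_prod (p : unitInterval) (y : ι → ℝ) (a : ℝ) :
    (setBernoulli Set.univ p).real {S : Set ι | a ≤ ∑ i, if i ∈ S then y i else 0} ≤
      Real.exp (-a) * ∏ i, ((p : ℝ) * Real.exp (y i) + (1 - p)) := by
  rw [← sum_setBernoulli_mul_prod, Finset.mul_sum]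
  set E : Set (Set ι) := {S : Set ι | a ≤ ∑ i, if i ∈ S then y i else 0} with hE
  have h₁ : (setBernoulli Set.univ p).real E =
      ∑ S ∈ E.toFinset, (setBernoulli Set.univ p).real {S} := by
    rw [sum_measureReal_singleton, Set.coe_toFinset]
  rw [h₁]
  refine (Finset.sum_le_sum fun S hS => ?_).trans
    (Finset.sum_le_sum_of_subset_of_nonneg (Finset.subset_univ _) fun S _ _ => ?_)
  · have hS' : a ≤ ∑ i, if i ∈ S then y i else 0 := by simpa [hE] using hS
    have h₂ : ∏ i, (if i ∈ S then Real.exp (y i) else 1) =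
        Real.exp (∑ i, if i ∈ S then y i else 0) := by
      rw [Real.exp_sum]
      refine Finset.prod_congr rfl fun i _ => ?_
      split_ifs <;> simp
    rw [h₂, mul_left_comm, ← Real.exp_add]
    exact le_mul_of_one_le_right measureReal_nonneg (Real.one_le_exp (by linarith))
  · refine mul_nonneg (Real.exp_pos _).le (mul_nonneg measureReal_nonneg ?_)
    refine Finset.prod_nonneg fun i _ => ?_
    split_ifs
    · exact (Real.exp_pos _).le
    · exact zero_le_one

open Classical in
/-- The number of elements of `A` that belong to `S`. -/
noncomputable def countIn (A : Finset ι) (S : Set ι) : ℝ := ∑ i ∈ A, if i ∈ S then 1 else 0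

/-- Chernoff's bound for the number of elements of `A` in a Bernoulli random set, for the upper tail
(`s = 1`) and the lower tail (`s = -1`). -/
theorem setBernoulli_real_countIn_le (p : unitInterval) (A : Finset ι) {M h s : ℝ}
    (hA : (A.card : ℝ) ≤ M) (hh : 0 ≤ h) (hh' : h ≤ 1) (hs : s = 1 ∨ s = -1) :
    (setBernoulli Set.univ p).real {S : Set ι | h * (p * M) ≤ s * (countIn A S - p * A.card)} ≤
      Real.exp (-(p * M * h ^ 2 / 4)) := by
  classical
  have hp : (0 : ℝ) ≤ p := p.2.1
  have hs' : s ^ 2 = 1 := by rcases hs with rfl | rfl <;> norm_num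
  -- The exponential parameter; its sign selects the tail, and `|l| ≤ 1` permits `exp l ≤ 1 + l + l
  -- ^ 2`.
  set l : ℝ := s * h / 2 with hl
  have hl' : |l| ≤ 1 := by
    rw [hl, abs_le]
    rcases hs with rfl | rfl <;> constructor <;> linarith
  have hl2 : l ^ 2 = h ^ 2 / 4 := by rw [hl, div_pow, mul_pow, hs']; ring
  -- The deviation event multiplied by `h / 2`. The moments give back `p * A.card * (l + h ^ 2 /
  -- 4)`, so `A.card ≤ M` leaves the exponent `-(p * M * h ^ 2 / 4)`. Measuring the deviation
  -- against `M` keeps the bound uniform for small `A`.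
  set a : ℝ := l * (p * A.card) + h ^ 2 * (p * M) / 2 with ha
  have h₁ := setBernoulli_real_le_exp_mul_prod p (fun i => if i ∈ A then l else 0) a
  refine le_trans (measureReal_mono fun S hS => ?_) (h₁.trans ?_)
  · have e : (∑ i, if i ∈ S then (if i ∈ A then l else 0) else 0) = l * countIn A S := by
      rw [countIn, Finset.mul_sum, ← Finset.sum_subset (Finset.subset_univ A)]
      · refine Finset.sum_congr rfl fun i hi => ?_
        rw [if_pos hi, mul_ite, mul_one, mul_zero]
      · intro i _ hi
        rw [if_neg hi, ite_self]
    change a ≤ _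
    refine le_of_le_of_eq ?_ e.symm
    have hS' : h * (p * M) ≤ s * (countIn A S - p * A.card) := hS
    have := mul_le_mul_of_nonneg_left hS' (show 0 ≤ h / 2 by linarith)
    rw [ha, hl]
    linarith
  · have h₃ : ∏ i, ((p : ℝ) * Real.exp (if i ∈ A then l else 0) + (1 - p)) =
        ∏ i ∈ A, ((p : ℝ) * Real.exp l + (1 - p)) := by
      rw [← Finset.prod_subset (Finset.subset_univ A)]
      · exact Finset.prod_congr rfl fun i hi => by rw [if_pos hi]
      · intro i _ hi
        rw [if_neg hi, Real.exp_zero]; ring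
    have h₄ : (p : ℝ) * Real.exp l + (1 - p) ≤ Real.exp (p * (l + l ^ 2)) := by
      have h₅ := (abs_le.1 (Real.abs_exp_sub_one_sub_id_le hl')).2
      have h₆ := Real.add_one_le_exp ((p : ℝ) * (l + l ^ 2))
      have h₇ := mul_le_mul_of_nonneg_left h₅ hp
      linarith
    have h₅ : 0 ≤ (p : ℝ) * Real.exp l + (1 - p) :=
      add_nonneg (mul_nonneg hp (Real.exp_pos _).le) (sub_nonneg.2 p.2.2)
    rw [h₃, Finset.prod_const]
    calc Real.exp (-a) * ((p : ℝ) * Real.exp l + (1 - p)) ^ A.card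
        ≤ Real.exp (-a) * Real.exp (p * (l + l ^ 2)) ^ A.card := by gcongr
      _ = Real.exp (-a + A.card * (p * (l + l ^ 2))) := by
        rw [← Real.exp_nat_mul, ← Real.exp_add]
      _ ≤ Real.exp (-(p * M * h ^ 2 / 4)) := by
        rw [Real.exp_le_exp, ha, hl2]
        have := mul_le_mul_of_nonneg_left hA (show 0 ≤ p * (h ^ 2 / 4) by positivity)
        linarith

end Chernoff

/-! ### From concentrated counts to the value of the percolated instance -/

namespace BoolCSP

open MeasureTheory ProbabilityTheory

variable {k : ℕ}

/-- The positions of the clauses that an assignment satisfies. -/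
def satSet (Φ : BoolCSP k) (σ : Fin Φ.numVars → Bool) : Finset (Fin Φ.clauses.length) :=
  Finset.univ.filter fun i => (Φ.clauses.get i).sat σ = true

theorem countP_finRange {m : ℕ} (q : Fin m → Bool) :
    (List.finRange m).countP q = (Finset.univ.filter fun i => q i = true).card := by
  rw [List.countP_eq_length_filter, ← List.toFinset_card_of_nodup ((List.nodup_finRange m).filter _),
    List.toFinset_filter, List.toFinset_finRange]

theorem card_satSet (Φ : BoolCSP k) (σ : Fin Φ.numVars → Bool) :
    (Φ.satSet σ).card = Φ.numSat σ := by
  rw [satSet, ← countP_finRange, numSat]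
  conv_rhs => rw [← List.map_get_finRange Φ.clauses, List.countP_map]
  rfl

open Classical in
theorem numSat_keep (Φ : BoolCSP k) (S : Set (Fin Φ.clauses.length)) (σ : Fin Φ.numVars → Bool) :
    ((Φ.keep S).numSat σ : ℝ) = countIn (Φ.satSet σ) S := by
  have h : (Φ.keep S).numSat σ = ((Φ.satSet σ).filter fun i => i ∈ S).card := by
    change (((List.finRange Φ.clauses.length).filter fun i => decide (i ∈ S)).map
      Φ.clauses.get).countP (fun C => C.sat σ) = _
    rw [List.countP_map, List.countP_filter, countP_finRange, satSet, Finset.filter_filter]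
    simp
  rw [h, countIn, Finset.sum_boole]

open Classical in
theorem length_keep (Φ : BoolCSP k) (S : Set (Fin Φ.clauses.length)) :
    ((Φ.keep S).clauses.length : ℝ) = countIn Finset.univ S := by
  have h : (Φ.keep S).clauses.length =
      ((Finset.univ : Finset (Fin Φ.clauses.length)).filter fun i => i ∈ S).card := by
    change (((List.finRange Φ.clauses.length).filter fun i => decide (i ∈ S)).map
      Φ.clauses.get).length = _
    rw [List.length_map, ← List.countP_eq_length_filter, countP_finRange]
    simp
  rw [h, countIn, Finset.sum_boole]

/-- Two maxima over the same assignments are compared by evaluating each objective at a maximiser of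
the other. -/
theorem abs_val_keep_sub_val_lt {Φ : BoolCSP k} {S : Set (Fin Φ.clauses.length)} {ε : ℝ}
    (h : ∀ σ, |(Φ.keep S).valOf σ - Φ.valOf σ| < ε) : |(Φ.keep S).val - Φ.val| < ε := by
  obtain ⟨σ, hσ⟩ := (Φ.keep S).exists_valOf_eq_val
  obtain ⟨τ, hτ⟩ := Φ.exists_valOf_eq_val
  have h₁ := (abs_lt.1 (h σ)).2
  have h₂ := (abs_lt.1 (h τ)).1
  have h₃ := Φ.valOf_le_val σ
  have h₄ := (Φ.keep S).valOf_le_val τ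
  rw [abs_lt, ← hσ, ← hτ]
  constructor
  · rw [hσ]; linarith
  · rw [hτ]; linarith

/-- If the number of surviving clauses, and the number of surviving clauses that any given
assignment satisfies, are close to their expectations, then so is the value. -/
theorem abs_val_keep_sub_val_lt_of_countIn {Φ : BoolCSP k} {S : Set (Fin Φ.clauses.length)}
    {ε p : ℝ} (hε : 0 < ε) (hε' : ε < 1) (hp : 0 < p) (hM : Φ.clauses ≠ [])
    (h : |countIn Finset.univ S - p * Φ.clauses.length| < ε / 4 * (p * Φ.clauses.length))
    (h' : ∀ σ, |countIn (Φ.satSet σ) S - p * (Φ.satSet σ).card| <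
      ε / 4 * (p * Φ.clauses.length)) :
    |(Φ.keep S).val - Φ.val| < ε := by
  refine abs_val_keep_sub_val_lt fun σ : Fin Φ.numVars → Bool => ?_
  set M : ℝ := (Φ.clauses.length : ℝ) with hMdef
  have hM0 : 0 < M := by
    rw [hMdef]; exact_mod_cast List.length_pos_iff.2 hM
  have hpM : 0 < p * M := mul_pos hp hM0
  set K := countIn Finset.univ S with hK
  have hK1 := abs_lt.1 h
  have hK2 : 3 / 4 * (p * M) < K := by nlinarith
  have hK0 : 0 < K := by nlinarith
  have hne : (Φ.keep S).clauses ≠ [] := by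
    intro h0
    have := Φ.length_keep S
    rw [h0, ← hK] at this
    simp at this
    linarith
  have e : (Φ.keep S).valOf σ = countIn (Φ.satSet σ) S / K := by
    rw [hK, ← length_keep, ← numSat_keep]
    exact valOf_of_ne_nil hne σ
  have hσ := abs_lt.1 (h' σ)
  have hcard : ((Φ.satSet σ).card : ℝ) = Φ.numSat σ := by rw [card_satSet]
  rw [hcard] at hσ
  refine (congrArg₂ (fun x y : ℝ => |x - y| < ε) e (valOf_of_ne_nil hM σ)).mpr ?_
  change |countIn (Φ.satSet σ) S / K - (Φ.numSat σ : ℝ) / M| < ε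
  set v : ℝ := (Φ.numSat σ : ℝ) / M with hv
  have hv0 : 0 ≤ v := by positivity
  have hv1 : v ≤ 1 := div_le_one_of_le₀ (by rw [hMdef]; exact_mod_cast Φ.numSat_le σ) hM0.le
  have hvM : (Φ.numSat σ : ℝ) = v * M := by rw [hv]; field_simp
  rw [hvM] at hσ
  -- The satisfied survivors differ from `v * K` by this error plus the one in `hσ`, together at
  -- most `ε / 2 * (p * M)`. This is below `ε * K` because `K > 3 / 4 * (p * M)`.
  have h₁ : |v * (p * M - K)| ≤ ε / 4 * (p * M) := by
    rw [abs_mul, abs_of_nonneg hv0, abs_sub_comm]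
    calc v * |K - p * M| ≤ 1 * |K - p * M| := by gcongr
      _ ≤ _ := by linarith
  rw [abs_le] at h₁
  have h₂ : ε * (3 / 4 * (p * M)) < ε * K := mul_lt_mul_of_pos_left hK2 hε
  have h₃ : 0 < ε * (p * M) := mul_pos hε hpM
  rw [abs_lt]
  constructor
  · rw [lt_sub_iff_add_lt, lt_div_iff₀ hK0]
    linarith
  · rw [sub_lt_iff_lt_add, div_lt_iff₀ hK0]
    linarith

/-- With high probability, the value of the percolated instance is close to the value of the
instance if the expected number of surviving clauses is large. -/
theorem le_clausePerc_real (Φ : BoolCSP k) {ε : ℝ} (hε : 0 < ε) (hε' : ε < 1)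
    {p : unitInterval} (hp : 0 < (p : ℝ)) (hM : Φ.clauses ≠ []) :
    1 - 2 * (2 ^ Φ.numVars + 1) * Real.exp (-(p * Φ.clauses.length * (ε / 4) ^ 2 / 4)) ≤
      (Φ.clausePerc p).real {S | |(Φ.keep S).val - Φ.val| < ε} := by
  set G : Set (Set (Fin Φ.clauses.length)) := {S | |(Φ.keep S).val - Φ.val| < ε} with hG
  set M : ℝ := (Φ.clauses.length : ℝ) with hMdef
  -- The index `none` stands for the total number of survivors, `some σ` for those satisfied by `σ`.
  -- With two tails each, the union bound has `2 * (2 ^ n + 1)` events.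
  let A : Option (Fin Φ.numVars → Bool) → Finset (Fin Φ.clauses.length) :=
    fun o => o.elim Finset.univ Φ.satSet
  let s : Bool → ℝ := fun b => if b then 1 else -1
  let F : Option (Fin Φ.numVars → Bool) × Bool → Set (Set (Fin Φ.clauses.length)) := fun x =>
    {S | ε / 4 * (p * M) ≤ s x.2 * (countIn (A x.1) S - p * (A x.1).card)}
  have hsub : Gᶜ ⊆ ⋃ x, F x := by
    intro S hS
    by_contra hx
    simp only [Set.mem_iUnion, not_exists] at hx
    have key : ∀ o, |countIn (A o) S - p * (A o).card| < ε / 4 * (p * M) := fun o => by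
      have h₁ : ¬ ε / 4 * (p * M) ≤ 1 * (countIn (A o) S - p * (A o).card) := hx (o, true)
      have h₂ : ¬ ε / 4 * (p * M) ≤ -1 * (countIn (A o) S - p * (A o).card) := hx (o, false)
      rw [abs_lt]
      constructor <;> linarith
    refine hS (abs_val_keep_sub_val_lt_of_countIn hε hε' hp hM ?_ fun σ => key (some σ))
    have := key none
    change |countIn Finset.univ S - p * (Finset.univ.card : ℝ)| < _ at this
    rwa [Finset.card_univ, Fintype.card_fin] at this
  have hF : ∀ x, (setBernoulli Set.univ p).real (F x) ≤
      Real.exp (-(p * M * (ε / 4) ^ 2 / 4)) := fun x => by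
    refine setBernoulli_real_countIn_le p (A x.1) ?_ (by linarith) (by linarith) ?_
    · rw [hMdef]
      exact_mod_cast (Finset.card_le_univ _).trans_eq (Fintype.card_fin _)
    · rcases x with ⟨o, _ | _⟩
      · exact Or.inr rfl
      · exact Or.inl rfl
  have h₁ : (setBernoulli Set.univ p).real Gᶜ ≤
      2 * (2 ^ Φ.numVars + 1) * Real.exp (-(p * M * (ε / 4) ^ 2 / 4)) := by
    refine (measureReal_mono hsub).trans ((measureReal_iUnion_fintype_le F).trans
      ((Finset.sum_le_sum fun x _ => hF x).trans (le_of_eq ?_)))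
    rw [Finset.sum_const, Finset.card_univ, Fintype.card_prod, Fintype.card_option,
      Fintype.card_fun, Fintype.card_bool, Fintype.card_fin, nsmul_eq_mul]
    push_cast
    ring
  rw [probReal_compl_eq_one_sub (Set.toFinite G).measurableSet] at h₁
  change _ ≤ (setBernoulli Set.univ p).real G
  linarith

end BoolCSP

/-! ### Numerical estimates -/

namespace BoolCSP

/-- The expected number of surviving clauses of the blow-up is large. -/
theorem le_mul_pow_of_lt {k n a : ℕ} {δ p : ℝ} (hn : 0 < n) (hδ : 0 < δ)
    (ha : (k : ℝ) + 2 ≤ a * δ)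
    (hp : 1 / (((n + 1) ^ a * n : ℕ) : ℝ) ^ ((k : ℝ) - 1 - δ) < p) :
    (((n + 1) ^ a * n : ℕ) : ℝ) * (n + 1) ≤ p * (((n + 1) ^ a : ℕ) : ℝ) ^ k := by
  set N : ℝ := (((n + 1) ^ a * n : ℕ) : ℝ) with hN
  set R : ℝ := (((n + 1) ^ a : ℕ) : ℝ) with hR
  have hn1 : (1 : ℝ) ≤ n := by exact_mod_cast hn
  have hR0 : 0 < R := by rw [hR]; positivity
  have hNR : N = R * n := by rw [hN, hR]; push_cast; ring
  have hN0 : 0 < N := by rw [hNR]; positivity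
  have hRN : R ≤ N := by rw [hNR]; exact le_mul_of_one_le_right hR0.le hn1
  -- The choice of `a` enters only here: `R ^ δ = (n + 1) ^ (a * δ)`.
  have h₁ : ((n : ℝ) + 1) ^ (k + 2) ≤ N ^ δ := by
    calc ((n : ℝ) + 1) ^ (k + 2) = ((n : ℝ) + 1) ^ ((k : ℝ) + 2) := by
          rw [← Real.rpow_natCast]; push_cast; rfl
      _ ≤ ((n : ℝ) + 1) ^ (a * δ) := Real.rpow_le_rpow_of_exponent_le (by linarith) ha
      _ = R ^ δ := by
          rw [Real.rpow_mul (by positivity), Real.rpow_natCast, hR]; push_cast; rfl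
      _ ≤ N ^ δ := Real.rpow_le_rpow hR0.le hRN hδ.le
  have h₂ : 1 / N ^ ((k : ℝ) - 1 - δ) = N * N ^ δ / N ^ k := by
    rw [Real.rpow_sub hN0, Real.rpow_sub hN0, Real.rpow_one, Real.rpow_natCast]
    field_simp
  rw [h₂] at hp
  have h₃ : N ^ k = R ^ k * (n : ℝ) ^ k := by rw [hNR, mul_pow]
  -- The factor `n ^ k` pays for `N ^ k / R ^ k`; the factor `n + 1` is the gain that later absorbs
  -- the constant depending on `ε`.
  have h₄ : (n : ℝ) ^ k * (n + 1) ≤ N ^ δ := by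
    refine le_trans ?_ h₁
    calc (n : ℝ) ^ k * (n + 1) ≤ ((n : ℝ) + 1) ^ k * (n + 1) ^ 2 := by
          gcongr
          · linarith
          · nlinarith
      _ = _ := by ring
  have hnk : 0 < (n : ℝ) ^ k := by positivity
  calc N * (n + 1) = N * ((n : ℝ) ^ k * (n + 1)) / N ^ k * R ^ k := by
        rw [h₃]; field_simp
    _ ≤ N * N ^ δ / N ^ k * R ^ k := by gcongr
    _ ≤ p * R ^ k := by gcongr

/-- Since `2 ^ N ≤ exp N`, the left side is at most `4 * exp (-N)`, and `exp N ≥ N ≥ 4 / η`. -/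
theorem two_mul_exp_bound {N : ℕ} {x η : ℝ} (hη : 0 < η) (hN : 4 / η ≤ N) (hx : 2 * (N : ℝ) ≤ x) :
    2 * ((2 : ℝ) ^ N + 1) * Real.exp (-x) ≤ η := by
  have h₁ : (2 : ℝ) ^ N ≤ Real.exp N := by
    rw [← Real.exp_one_pow]
    exact pow_le_pow_left₀ (by norm_num) (by linarith [Real.add_one_le_exp (1 : ℝ)]) N
  have h₂ : (1 : ℝ) ≤ 2 ^ N := one_le_pow₀ (by norm_num)
  have h₃ : Real.exp N * Real.exp (-x) ≤ Real.exp (-N) := by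
    rw [← Real.exp_add, Real.exp_le_exp]; linarith
  have h₄ : (4 / η) * Real.exp (-N) ≤ 1 := by
    have h₅ : 4 / η ≤ Real.exp N := hN.trans (by linarith [Real.add_one_le_exp (N : ℝ)])
    calc (4 / η) * Real.exp (-N) ≤ Real.exp N * Real.exp (-N) := by gcongr
      _ = 1 := by rw [← Real.exp_add, add_neg_cancel, Real.exp_zero]
  rw [div_mul_eq_mul_div, div_le_one hη] at h₄
  have h₅ : 2 * ((2 : ℝ) ^ N + 1) * Real.exp (-x) ≤ 4 * (Real.exp N * Real.exp (-x)) := by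
    rw [← mul_assoc]
    exact mul_le_mul_of_nonneg_right (by linarith) (Real.exp_pos _).le
  linarith

end BoolCSP

/-! ### Choice of the parameters and conclusion -/

theorem mainTheorem7 (k : ℕ) (ε δ : ℝ) (hε : ε ∈ Set.Ioo (0 : ℝ) 1) (hδ : δ ∈ Set.Ioo (0 : ℝ) 1) :
    ∃ red : BoolCSP k → BoolCSP k,
      BoolCSP.PolyTime red ∧
      (∀ Φ : BoolCSP k, Φ.IsSimple →
        (red Φ).IsSimple ∧
        (∃ R : ℕ, 0 < R ∧ BoolCSP.IsBlowUp R Φ (red Φ)) ∧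
        (red Φ).predicates = Φ.predicates ∧
        (red Φ).val = Φ.val ∧
        (Φ.val = 1 → ∀ p : unitInterval,
          1 / ((red Φ).numVars : ℝ) ^ ((k : ℝ) - 1 - δ) < (p : ℝ) →
          ∀ᵐ S ∂((red Φ).clausePerc p), ((red Φ).keep S).val = 1)) ∧
      (∀ η : ℝ, 0 < η → ∃ N₀ : ℕ, ∀ Φ : BoolCSP k, Φ.IsSimple → Φ.val < 1 →
        N₀ ≤ (red Φ).numVars → ∀ p : unitInterval,
          1 / ((red Φ).numVars : ℝ) ^ ((k : ℝ) - 1 - δ) < (p : ℝ) →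
          1 - η ≤ ((red Φ).clausePerc p).real
            {S | |((red Φ).keep S).val - Φ.val| < ε}) := by
  obtain ⟨hε0, hε1⟩ := hε
  obtain ⟨hδ0, hδ1⟩ := hδ
  obtain ⟨a, ha⟩ := exists_nat_ge (((k : ℝ) + 2) / δ)
  rw [div_le_iff₀ hδ0] at ha
  -- The base `n + 1` instead of `n` keeps the number of copies positive even without variables.
  refine ⟨fun Φ => Φ.blowUp ((Φ.numVars + 1) ^ a), BoolCSP.polyTime_blowUp k a,
    fun Φ hΦ => ?_, fun η hη => ?_⟩
  · have hR : 0 < (Φ.numVars + 1) ^ a := by positivity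
    have hval := BoolCSP.val_blowUp hR Φ
    exact ⟨hΦ.blowUp _, ⟨_, hR, BoolCSP.isBlowUp_blowUp _ Φ⟩, BoolCSP.predicates_blowUp hR Φ,
      hval, fun h p _ => Filter.Eventually.of_forall
        fun S => BoolCSP.val_keep_eq_one (hval.trans h) S⟩
  -- The Chernoff exponent is at least `N * (n + 1) * ε ^ 2 / 64`, as `(ε / 4) ^ 2 / 4 = ε ^ 2 /
  -- 64`. It reaches the required `2 * N` once `(n + 1) * ε ^ 2 ≥ 128`.
  · obtain ⟨n₀, hn₀⟩ := exists_nat_ge (128 / ε ^ 2)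
    obtain ⟨n₁, hn₁⟩ := exists_nat_ge (4 / η)
    -- The first entry gives `N ≥ 4 / η` and `N > 0`, hence `n > 0`. The second forces `n ≥ n₀`,
    -- because `N ≤ (n + 1) ^ (a + 1)`.
    refine ⟨max (n₁ + 1) ((n₀ + 1) ^ (a + 1)), fun Φ _ hlt hN p hp => ?_⟩
    have hR : 0 < (Φ.numVars + 1) ^ a := by positivity
    change max (n₁ + 1) ((n₀ + 1) ^ (a + 1)) ≤ (Φ.numVars + 1) ^ a * Φ.numVars at hN
    have hN₁ := (le_max_left _ _).trans hN
    have hn : 0 < Φ.numVars := by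
      rcases Nat.eq_zero_or_pos Φ.numVars with h | h
      · rw [h, mul_zero] at hN₁; omega
      · exact h
    have hn' : n₀ ≤ Φ.numVars := by
      have h₁ : (n₀ + 1) ^ (a + 1) ≤ (Φ.numVars + 1) ^ (a + 1) := by
        refine ((le_max_right _ _).trans hN).trans ?_
        rw [pow_succ]
        exact Nat.mul_le_mul_left _ (Nat.le_succ _)
      have := (Nat.pow_le_pow_iff_left (Nat.succ_ne_zero a)).1 h₁
      omega
    -- An instance without clauses has value `1`, so `val < 1` supplies the one clause that the size
    -- estimate needs.
    have hne : Φ.clauses ≠ [] := fun h => by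
      rw [BoolCSP.val_of_nil h] at hlt
      exact lt_irrefl _ hlt
    have hm : 0 < Φ.clauses.length := List.length_pos_iff.2 hne
    have hlen := BoolCSP.length_blowUp ((Φ.numVars + 1) ^ a) Φ
    have hne' : (Φ.blowUp ((Φ.numVars + 1) ^ a)).clauses ≠ [] := by
      rw [← List.length_pos_iff, hlen]; positivity
    have hp0 : 0 < (p : ℝ) := lt_of_le_of_lt (by positivity) hp
    have key := BoolCSP.le_clausePerc_real (Φ.blowUp ((Φ.numVars + 1) ^ a)) hε0 hε1 hp0 hne'
    rw [BoolCSP.val_blowUp hR] at key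
    refine le_trans (sub_le_sub_left ?_ 1) key
    have hx := BoolCSP.le_mul_pow_of_lt hn hδ0 ha hp
    refine BoolCSP.two_mul_exp_bound (N := (Φ.numVars + 1) ^ a * Φ.numVars) hη
      (hn₁.trans (by exact_mod_cast (by omega))) ?_
    rw [hlen]
    have h₁ : 128 ≤ ((Φ.numVars : ℝ) + 1) * ε ^ 2 := by
      rw [div_le_iff₀ (by positivity)] at hn₀
      refine hn₀.trans ?_
      gcongr
      have : (n₀ : ℝ) ≤ Φ.numVars := by exact_mod_cast hn'
      linarith
    have h₂ : (p : ℝ) * (((Φ.numVars + 1) ^ a : ℕ) : ℝ) ^ k ≤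
        p * ((Φ.clauses.length * ((Φ.numVars + 1) ^ a) ^ k : ℕ) : ℝ) := by
      refine mul_le_mul_of_nonneg_left ?_ hp0.le
      exact_mod_cast Nat.le_mul_of_pos_left _ hm
    have h₃ := mul_le_mul_of_nonneg_right (hx.trans h₂) (sq_nonneg ε)
    have h₄ := mul_le_mul_of_nonneg_left h₁
      (Nat.cast_nonneg (α := ℝ) ((Φ.numVars + 1) ^ a * Φ.numVars))
    linarith
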